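/- Notation. Let $M\ge 2$ be the number of transmit antennas, $L=2^{\lceil\log_2 M\rceil}$ and $1\le n\le\lceil\log_2M\rceil$. For vectors $s$ whose length is a power of two define square matrices by $G_1[s]=s$ and $$G_{2m}[s]=\begin{pmatrix}G_m[s_1]&G_m[s_2]\\-G_m[s_2^*]&G_m[s_1^*]\end{pmatrix},$$ where $s_1,s_2$ are the halves of $s$ and $^*$ is entrywise conjugation. The partition vectors are $\mathcal A_{1,1}(s)=s$, $\mathcal A_{1,2}(s)=0$ and $\mathcal A_{2m,1}(s)=(\mathcal A_{m,1}(s_1),\mathcal A_{m,2}(s_2))$, $\mathcal A_{2m,2}(s)=(\mathcal A_{m,2}(s_1),\mathcal A_{m,1}(s_2))$. The vectors of the symbols of the two partitions are $v_{2,1}(s)=s_1$, $v_{2,2}(s)=-s_2$ and $v_{2m,1}(s)=(v_{m,1}(s_1),v_{m,2}(s_2))$, $v_{2m,2}(s)=-(v_{m,2}(s_1),v_{m,1}(s_2))$. Let $W_{2,1}=W_{2,2}=1$; each column $x$ of $W_{m,1}$ and the corresponding column $y$ of $W_{m,2}$ give the two adjacent columns $\frac1{\sqrt2}(x;y)$,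 $\frac1{\sqrt2}(x;-y)$ of $W_{2m,1}$, and each column $(a;b)$ of $W_{2m,1}$ (with halves $a,b$) gives the column $(b;-a)$ of $W_{2m,2}$. The code. Given angles $\theta\in\mathbb R^L$ (constellation rotation), information symbols $c\in\mathbb C^L$ are rotated to $c'_j=e^{i\theta_j}c_j$ and precoded to $s=\mathcal R c$, the vector with $$v_{L,i}(s)=W_{L,i}\,B\,v_{L,i}(c'),\qquad i=1,2,$$ where $B$ is block diagonal with $2^{n-1}$ equal blocks $W_{L/2^{n-1},1}$. The code matrix consists of $M$ chosen columns of $G_L[\mathcal R c]$ (all columns if $M$ is a power of two); it is sent in $L$ channel uses, and the received signal is $X=\sqrt{\rho/M}\,GH+V$ with $V$ having i.i.d. $\mathcal{CN}(0,1)$ entries and $H$ known to the receiver. The diversity for a finite signal alphabet $\mathcal A\subset\mathbb C$ is the minimum rank of the difference of the code matrices of two distinct vectors in $\mathcal A^L$. $K$ symbols are ML decoded jointly if the $L$ symbols split, independently of $H$, $X$, $\rho$ and the number of receive antennas, into groups of exactly $K$ symbols such that the log-likelihood is a sum of metrics each depending on one group only; then for every alphabet the ML decisions are obtained by maximising each group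 metric separately. Claim. 1. For $i=1,2$, $W_{L,i}$ is unitary and diagonalises the equivalent channel of every $h\in\mathbb C^L$: there are $\lambda_j(h)\ge0$ with $\|G_L[\mathcal A_{L,i}(s)]h\|^2=\sum_j\lambda_j(h)\,|(W_{L,i}^\dagger v_{L,i}(s))_j|^2$ for all $s\in\mathbb C^L$. 2. For all rotations and all choices of columns, $\mathcal R$ is unitary, the code has rate $1$ symbol per channel use, and it admits ML decoding of $L/2^n=2^{\lceil\log_2M\rceil-n}$ symbols jointly ($M/2^n$ if $M$ is a power of two). 3. There is a choice of $M$ columns such that for every finite alphabet $\mathcal A\subset\mathbb C$ with at least two points there is a rotation $\theta$ for which the diversity is exactly $\min(M,2^{\lceil\log_2M\rceil-n+1})$. 4. Full diversity requires $n=1$, i.e. decoding $L/2$ symbols jointly ($M/2$ if $M$ is a power of two): if for some rotation, some choice of columns and some finite alphabet with at least two points the diversity is $M$, then $n=1$. 5. If $M>2$ and $n=\lceil\log_2M\rceil$ (single-symbol decoding; here $B$ is the identity), then for every rotation and every finite alphabet $\mathcal A$ with at least two points the minimum determinant is zero: for $i=1,2$, $$\min\big|\det G_L[\mathcal A_{L,i}(\mathcal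 R(c-e))]\big|=0$$ over $c,e\in\mathcal A^L$ with $\mathcal A_{L,i}(c)\ne\mathcal A_{L,i}(e)$, and also $\min\big|\det G_L[\mathcal R(c-e)]\big|=0$ over $c\neq e$ in $\mathcal A^L$. -/

import Mathlib

open scoped Matrix

namespace STBC

/-! ### General space-time block codes -/

/-- A space-time block code: it sends a vector of complex information symbols (indexed by `P`)
to a matrix whose rows are the channel uses `T` and whose columns are the antennas `A`. -/
abbrev Code (P T A : Type) : Type := (P → ℂ) → Matrix T A ℂ

section General

variable {P T A R : Type} [Fintype P] [Fintype T] [Fintype A] [Fintype R]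

/-- Average rate: symbols per channel use. -/
def Code.rate (_ : Code P T A) : ℚ := (Fintype.card P : ℚ) / (Fintype.card T : ℚ)

/-- Likelihood of the received matrix `X = √(ρ/M) • (C c) * H + V`, given the channel `H` (known to
the receiver) and the symbol vector `c`, where `M` is the number of transmit antennas and the
entries of the noise `V` are independent circularly symmetric complex Gaussian with unit variance
(density `π⁻¹ exp (-‖z‖ ^ 2)`). -/
noncomputable def Code.likelihood (C : Code P T A) (ρ : ℝ) (H : Matrix A R ℂ) (X : Matrix T R ℂ)
    (c : P → ℂ) : ℝ :=
  ∏ t : T, ∏ r : R, Real.pi⁻¹ *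
    Real.exp (-‖X t r - ((Real.sqrt (ρ / Fintype.card A) : ℝ) : ℂ) * (C c * H) t r‖ ^ 2)

/-- `c` is a maximum likelihood decision when all symbols are drawn from `𝒜`. -/
def Code.IsMLDecision (C : Code P T A) (𝒜 : Finset ℂ) (ρ : ℝ) (H : Matrix A R ℂ)
    (X : Matrix T R ℂ) (c : P → ℂ) : Prop :=
  (∀ p, c p ∈ 𝒜) ∧
    ∀ c' : P → ℂ, (∀ p, c' p ∈ 𝒜) → C.likelihood ρ H X c' ≤ C.likelihood ρ H X c

/-- The code admits ML decoding of `K` symbols jointly: the symbols split (independently of the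
channel, of the SNR and of the received signal) into groups of exactly `K` symbols, such that the
log-likelihood is a sum of metrics, each of which depends on the symbols of one group only;
consequently, for every signal alphabet, the ML decisions are the vectors that maximise each group
metric separately. -/
def Code.MLDecodesJointly (C : Code P T A) (K : ℕ) : Prop :=
  ∃ (q : ℕ) (grp : P → Fin q),
    (∀ g, Nat.card {p : P // grp p = g} = K) ∧
    ∀ (N : ℕ) (ρ : ℝ), 0 < ρ → ∀ (H : Matrix A (Fin N) ℂ) (X : Matrix T (Fin N) ℂ),
      ∃ metric : (g : Fin q) → ({p : P // grp p = g} → ℂ) → ℝ,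
        (∀ c : P → ℂ,
          Real.log (C.likelihood ρ H X c) = ∑ g, metric g (fun p => c p.1)) ∧
        (∀ (𝒜 : Finset ℂ) (c : P → ℂ),
          C.IsMLDecision 𝒜 ρ H X c ↔
            (∀ p, c p ∈ 𝒜) ∧
            ∀ (g : Fin q) (w : {p : P // grp p = g} → ℂ), (∀ p, w p ∈ 𝒜) →
              metric g w ≤ metric g (fun p => c p.1))

/-- Diversity with symbols drawn from `𝒜` (rank criterion): `d` is the minimum rank of the
difference of the code matrices of two distinct symbol vectors. -/
def Code.HasDiversity (C : Code P T A) (𝒜 : Finset ℂ) (d : ℕ) : Prop :=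
  IsLeast {r : ℕ | ∃ u v : P → ℂ, (∀ p, u p ∈ 𝒜) ∧ (∀ p, v p ∈ 𝒜) ∧ u ≠ v ∧
    r = (C u - C v).rank} d

end General

/-! ### The iterative construction

Vectors of length `2 ^ k` are indexed by `Idx k`; the first and the last half of the coordinates of
a vector of length `2 ^ (k + 1)` are those of the form `Sum.inl j` and `Sum.inr j`. -/

/-- An index set with `2 ^ k` elements. -/
@[reducible] def Idx : ℕ → Type
  | 0 => Unit
  | k + 1 => Idx k ⊕ Idx k

instance instFintypeIdx : (k : ℕ) → Fintype (Idx k)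
  | 0 => inferInstanceAs (Fintype Unit)
  | k + 1 =>
    haveI := instFintypeIdx k
    inferInstanceAs (Fintype (Idx k ⊕ Idx k))

instance instDecidableEqIdx : (k : ℕ) → DecidableEq (Idx k)
  | 0 => inferInstanceAs (DecidableEq Unit)
  | k + 1 =>
    haveI := instDecidableEqIdx k
    inferInstanceAs (DecidableEq (Idx k ⊕ Idx k))

theorem card_idx (k : ℕ) : Fintype.card (Idx k) = 2 ^ k := by
  induction k with
  | zero => rfl
  | succ k ih =>
    have h : Fintype.card (Idx (k + 1)) = Fintype.card (Idx k ⊕ Idx k) := by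
      convert rfl
    rw [h, Fintype.card_sum, ih, pow_succ, mul_two]

/-- The code matrix `G_{2^k}[s]`: `G_1[s] = s_1` and
`G_{2M}[s] = [[G_M[s₁], G_M[s₂]], [-G_M[s₂^*], G_M[s₁^*]]]`, where `s₁`, `s₂` are the halves of `s`
and `*` is entrywise conjugation. -/
noncomputable def codeMatrix : (k : ℕ) → (Idx k → ℂ) → Matrix (Idx k) (Idx k) ℂ
  | 0, s => Matrix.of fun _ _ => s ()
  | k + 1, s =>
    Matrix.fromBlocks
      (codeMatrix k fun j => s (Sum.inl j)) (codeMatrix k fun j => s (Sum.inr j))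
      (-codeMatrix k fun j => star (s (Sum.inr j))) (codeMatrix k fun j => star (s (Sum.inl j)))

/-- The partition vectors `𝒜_{2^k,i}(s)`; `false` stands for the first partition (`i = 1`) and
`true` for the second (`i = 2`). They agree with `s` on the indices of the partition and vanish
elsewhere. -/
noncomputable def partition : (k : ℕ) → Bool → (Idx k → ℂ) → (Idx k → ℂ)
  | 0, false, s => s
  | 0, true, _ => 0
  | k + 1, i, s =>
    Sum.elim (partition k i fun j => s (Sum.inl j)) (partition k (!i) fun j => s (Sum.inr j))

/-- The `2^k × 2^(k+1)` matrix `V` with `V s = v_{2^(k+1),i}(s)`, the vector of the symbols of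
partition `i`. With `s₁`, `s₂` the halves of `s`, the order and the signs are those produced by the
recursion for the equivalent channels:
`v_{2,1}(s) = s_1`, `v_{2,2}(s) = -s_2`, `v_{2M,1}(s) = (v_{M,1}(s₁), v_{M,2}(s₂))`,
`v_{2M,2}(s) = -(v_{M,2}(s₁), v_{M,1}(s₂))`. -/
noncomputable def partMat : (k : ℕ) → Bool → Matrix (Idx k) (Idx (k + 1)) ℂ
  | 0, false => Matrix.of fun _ j => Sum.elim (fun _ => (1 : ℂ)) (fun _ => 0) j
  | 0, true => Matrix.of fun _ j => Sum.elim (fun _ => (0 : ℂ)) (fun _ => -1) j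
  | k + 1, false => Matrix.fromBlocks (partMat k false) 0 0 (partMat k true)
  | k + 1, true => -Matrix.fromBlocks (partMat k true) 0 0 (partMat k false)

/-- `j ↦ ⌊j / 2⌋`, for indices numbered from `0`. -/
def parent : (k : ℕ) → Idx (k + 1) → Idx k
  | 0, _ => ()
  | k + 1, Sum.inl j => Sum.inl (parent k j)
  | k + 1, Sum.inr j => Sum.inr (parent k j)

/-- `j ↦ (-1)^j`, for indices numbered from `0`. -/
def altSign : (k : ℕ) → Idx (k + 1) → ℂ
  | 0, Sum.inl _ => 1
  | 0, Sum.inr _ => -1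
  | k + 1, Sum.inl j => altSign k j
  | k + 1, Sum.inr j => altSign k j

/-- The eigenvector matrices `W_{2^(k+1),i}`, of size `2^k`. `W_{2,i} = 1`. Corresponding columns
`x` of `W_{M,1}` and `y` of `W_{M,2}` give the two adjacent columns `(x; y)/√2`, `(x; -y)/√2` of
`W_{2M,1}`; and a column `(a; b)` of `W_{2M,1}` gives the column `(b; -a)` of `W_{2M,2}`. -/
noncomputable def eigMat : (k : ℕ) → Bool → Matrix (Idx k) (Idx k) ℂ
  | 0, _ => 1
  | k + 1, false => Matrix.of fun p j => ((Real.sqrt 2 : ℝ) : ℂ)⁻¹ *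
      Sum.elim (fun p' => eigMat k false p' (parent k j))
        (fun p' => altSign k j * eigMat k true p' (parent k j)) p
  | k + 1, true => Matrix.of fun p j => ((Real.sqrt 2 : ℝ) : ℂ)⁻¹ *
      Sum.elim (fun p' => altSign k j * eigMat k true p' (parent k j))
        (fun p' => -eigMat k false p' (parent k j)) p

/-- The block diagonal matrix of size `2^k` with `2^r` equal diagonal blocks `W_{2^(k+1-r),1}`
(for `r ≤ k`), each of size `2^(k-r)`. -/
noncomputable def blockW : (k r : ℕ) → Matrix (Idx k) (Idx k) ℂ
  | k, 0 => eigMat k false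
  | 0, _ + 1 => 1
  | k + 1, r + 1 => Matrix.fromBlocks (blockW k r) 0 0 (blockW k r)

/-- The precoding matrix `ℛ` for `L = 2^(k+1)` and parameter `n`, with rotation angles `θ`.
Symbol `j` is rotated by `exp (i θ_j)`; then `s = ℛ c` is determined by
`v_{L,i}(s) = W_{L,i} B v_{L,i}(c')`, `i = 1, 2`, where `c'` are the rotated symbols and `B` is
block diagonal with blocks `W_{L/2^(n-1),1}`. -/
noncomputable def precoder (k n : ℕ) (θ : Idx (k + 1) → ℝ) :
    Matrix (Idx (k + 1)) (Idx (k + 1)) ℂ :=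
  (∑ i : Bool, (partMat k i)ᵀ * eigMat k i * blockW k (n - 1) * partMat k i) *
    Matrix.diagonal fun j => Complex.exp (Complex.I * (θ j : ℂ))

/-- The code for `M` transmit antennas: the `2^(k+1) × 2^(k+1)` code matrix `G[ℛ c]`, of which only
the `M` columns selected by `J` are kept. -/
noncomputable def proposedCode (k n : ℕ) (θ : Idx (k + 1) → ℝ) {M : ℕ} (J : Fin M ↪ Idx (k + 1)) :
    Code (Idx (k + 1)) (Idx (k + 1)) (Fin M) :=
  fun c => (codeMatrix (k + 1) (precoder k n θ *ᵥ c)).submatrix id J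

end STBC

namespace STBC

/-! ### Index bookkeeping -/

/-! Put L = 2^(k+1) and r = n - 1. Attach to a vector s its coordinates a_j, b_j in the real
orthonormal eigenbases of the two partitions (`eigCoord`). In these coordinates G[s] splits into 2^k
independent 2 × 2 Alamouti blocks: up to the factor √2^k, the coordinates (c_j, d_j) of h go to (a_j
c_j + b_j d_j, a_j^* d_j - b_j^* c_j), a quaternion product (`eigCoord_codeMatrix`). Quaternion
norms multiply, so ‖G[s]h‖² = Σ_j 2^k (|a_j|² + |b_j|²)(|c_j|² + |d_j|²). This identity yields the
eigenvalues of the equivalent channel, the kernel of G[s], and the splitting of the energy over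
groups of symbols.

The precoder cancels W: the coordinates of ℛc are B v_{L,i}(c') (`eigCoord_precoder_mulVec`). No
entry of W vanishes, so coordinate j of partition i involves exactly the symbols of partition i in
the block of j. This gives 2^(r+1) groups of 2^(k-r) symbols; the linear part of the log-likelihood
splits over any grouping.

Changing one symbol touches only the 2^(k-r) quaternions of one block, so the rank is at most
2^(k-r+1). This bounds the diversity, forces n = 1 when the diversity is M > 2^k, and makes
determinants vanish when r = k ≥ 1. Conversely, for generic angles every nonzero difference has a
block all of whose quaternions are nonzero (`exists_rotation_eigNorm_ne_zero`), and some 2^(k-r+1)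
columns support no nonzero vector whose coordinates vanish on a whole block
(`exists_columns_injective`). Selecting columns from that set first gives the matching lower bound.
-/

theorem altSign_eq (k : ℕ) (j : Idx (k + 1)) : altSign k j = 1 ∨ altSign k j = -1 := by
  induction k with
  | zero => rcases j with j | j <;> simp [altSign]
  | succ k ih => rcases j with j | j <;> simpa [altSign] using ih j

theorem altSign_mul_self (k : ℕ) (j : Idx (k + 1)) : altSign k j * altSign k j = 1 := by
  rcases altSign_eq k j with h | h <;> simp [h]

theorem star_altSign (k : ℕ) (j : Idx (k + 1)) : star (altSign k j) = altSign k j := by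
  rcases altSign_eq k j with h | h <;> simp [h]

theorem altSign_ne_zero (k : ℕ) (j : Idx (k + 1)) : altSign k j ≠ 0 := by
  rcases altSign_eq k j with h | h <;> simp [h]

theorem eq_of_parent_altSign (k : ℕ) {j l : Idx (k + 1)} (hp : parent k j = parent k l)
    (hs : altSign k j = altSign k l) : j = l := by
  have h1 : (1 : ℂ) ≠ -1 := by norm_num
  induction k with
  | zero =>
    rcases j with j | j <;> rcases l with l | l
    · rfl
    · exact absurd hs h1
    · exact absurd hs h1.symm
    · rfl
  | succ k ih =>
    rcases j with j | j <;> rcases l with l | l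
    · exact congrArg _ (ih (Sum.inl.inj hp) hs)
    · cases hp
    · cases hp
    · exact congrArg _ (ih (Sum.inr.inj hp) hs)

theorem sum_idx_succ {N : Type*} [AddCommMonoid N] (k : ℕ) (f : Idx (k + 1) → N) :
    ∑ j, f j = ∑ j : Idx k, f (Sum.inl j) + ∑ j : Idx k, f (Sum.inr j) :=
  Fintype.sum_sum_type f

/-- The halves of a vector are separated by the leading bit of the index, whereas `parent` removes
the last bit and `altSign` records it. Each pair (parent, sign) occurs exactly once. -/
theorem sum_parent_altSign {N : Type*} [AddCommMonoid N] (k : ℕ) (F : Idx k → ℂ → N) :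
    ∑ j : Idx (k + 1), F (parent k j) (altSign k j) = ∑ j, (F j 1 + F j (-1)) := by
  induction k with
  | zero =>
    rw [sum_idx_succ]
    exact Finset.sum_add_distrib.symm
  | succ k ih =>
    rw [sum_idx_succ (k + 1), sum_idx_succ k fun j => F j 1 + F j (-1)]
    exact congrArg₂ (· + ·) (ih fun j => F (Sum.inl j)) (ih fun j => F (Sum.inr j))

theorem exists_parent_altSign (k : ℕ) (j : Idx k) :
    (∃ l, parent k l = j ∧ altSign k l = 1) ∧ ∃ l, parent k l = j ∧ altSign k l = -1 := by
  induction k with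
  | zero => exact ⟨⟨Sum.inl (), rfl, rfl⟩, ⟨Sum.inr (), rfl, rfl⟩⟩
  | succ k ih =>
    rcases j with j | j
    · obtain ⟨⟨l, h1, h2⟩, ⟨l', h1', h2'⟩⟩ := ih j
      exact ⟨⟨Sum.inl l, congrArg _ h1, h2⟩, ⟨Sum.inl l', congrArg _ h1', h2'⟩⟩
    · obtain ⟨⟨l, h1, h2⟩, ⟨l', h1', h2'⟩⟩ := ih j
      exact ⟨⟨Sum.inr l, congrArg _ h1, h2⟩, ⟨Sum.inr l', congrArg _ h1', h2'⟩⟩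

/-! ### The eigenvector matrices -/

theorem sqrt_two_mul_self : ((Real.sqrt 2 : ℝ) : ℂ) * ((Real.sqrt 2 : ℝ) : ℂ) = 2 := by
  rw [← Complex.ofReal_mul, Real.mul_self_sqrt (by norm_num)]
  norm_num

theorem sqrt_two_ne_zero : ((Real.sqrt 2 : ℝ) : ℂ) ≠ 0 := by
  intro h
  have := sqrt_two_mul_self
  rw [h] at this
  norm_num at this

theorem star_sqrt_two : star ((Real.sqrt 2 : ℝ) : ℂ) = ((Real.sqrt 2 : ℝ) : ℂ) :=
  Complex.conj_ofReal _

theorem eigMat_false_inl (k : ℕ) (p : Idx k) (j : Idx (k + 1)) :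
    eigMat (k + 1) false (Sum.inl p) j =
      ((Real.sqrt 2 : ℝ) : ℂ)⁻¹ * eigMat k false p (parent k j) := rfl

theorem eigMat_false_inr (k : ℕ) (p : Idx k) (j : Idx (k + 1)) :
    eigMat (k + 1) false (Sum.inr p) j =
      ((Real.sqrt 2 : ℝ) : ℂ)⁻¹ * (altSign k j * eigMat k true p (parent k j)) := rfl

theorem eigMat_true_inl (k : ℕ) (p : Idx k) (j : Idx (k + 1)) :
    eigMat (k + 1) true (Sum.inl p) j =
      ((Real.sqrt 2 : ℝ) : ℂ)⁻¹ * (altSign k j * eigMat k true p (parent k j)) := rfl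

theorem eigMat_true_inr (k : ℕ) (p : Idx k) (j : Idx (k + 1)) :
    eigMat (k + 1) true (Sum.inr p) j =
      ((Real.sqrt 2 : ℝ) : ℂ)⁻¹ * -eigMat k false p (parent k j) := rfl

theorem star_eigMat (k : ℕ) (i : Bool) (p j : Idx k) : star (eigMat k i p j) = eigMat k i p j := by
  induction k generalizing i with
  | zero => simp [eigMat]
  | succ k ih =>
    cases i <;> rcases p with p | p
    · simp only [eigMat_false_inl, star_mul', star_inv₀, star_sqrt_two, ih]
    · simp only [eigMat_false_inr, star_mul', star_inv₀, star_sqrt_two, star_altSign, ih]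
    · simp only [eigMat_true_inl, star_mul', star_inv₀, star_sqrt_two, star_altSign, ih]
    · simp only [eigMat_true_inr, star_mul', star_inv₀, star_sqrt_two, star_neg, ih]

/-- This makes a precoded symbol spread over all of its block, and it starts the induction in
`exists_rows_injective`. -/
theorem eigMat_ne_zero (k : ℕ) (i : Bool) (p j : Idx k) : eigMat k i p j ≠ 0 := by
  induction k generalizing i with
  | zero => simp [eigMat]
  | succ k ih =>
    have h := inv_ne_zero sqrt_two_ne_zero
    cases i <;> rcases p with p | p
    · exact mul_ne_zero h (ih _ _ _)
    · exact mul_ne_zero h (mul_ne_zero (altSign_ne_zero k j) (ih _ _ _))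
    · exact mul_ne_zero h (mul_ne_zero (altSign_ne_zero k j) (ih _ _ _))
    · exact mul_ne_zero h (neg_ne_zero.2 (ih _ _ _))

theorem conjTranspose_eigMat (k : ℕ) (i : Bool) : (eigMat k i)ᴴ = (eigMat k i)ᵀ := by
  ext p j
  exact star_eigMat k i j p

/-- This is the shape in which the Gram matrix of the columns arises: one half contributes ½δ of the
parents, the other the same times both signs, and opposite signs cancel. -/
theorem one_parent_apply (k : ℕ) (j l : Idx (k + 1)) :
    (2 : ℂ)⁻¹ * (1 + altSign k j * altSign k l) *
      (1 : Matrix (Idx k) (Idx k) ℂ) (parent k j) (parent k l) =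
      (1 : Matrix (Idx (k + 1)) (Idx (k + 1)) ℂ) j l := by
  by_cases h : j = l
  · subst h
    rw [Matrix.one_apply_eq, Matrix.one_apply_eq, altSign_mul_self]
    norm_num
  · rw [Matrix.one_apply_ne h]
    by_cases hp : parent k j = parent k l
    · have hs : altSign k j ≠ altSign k l := fun hs => h (eq_of_parent_altSign k hp hs)
      rcases altSign_eq k j with h1 | h1 <;> rcases altSign_eq k l with h2 | h2 <;>
        simp_all
    · rw [Matrix.one_apply_ne hp, mul_zero]

theorem transpose_mul_eigMat (k : ℕ) (i : Bool) : (eigMat k i)ᵀ * eigMat k i = 1 := by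
  induction k generalizing i with
  | zero => simp [eigMat]
  | succ k ih =>
    have e (i : Bool) (j l : Idx k) :
        ∑ p, eigMat k i p j * eigMat k i p l = (1 : Matrix (Idx k) (Idx k) ℂ) j l := by
      rw [← ih i]
      rfl
    have h2 : ((Real.sqrt 2 : ℝ) : ℂ)⁻¹ * ((Real.sqrt 2 : ℝ) : ℂ)⁻¹ = 2⁻¹ := by
      rw [← mul_inv, sqrt_two_mul_self]
    ext j l
    rw [← one_parent_apply, Matrix.mul_apply, sum_idx_succ]
    cases i
    · simp only [Matrix.transpose_apply, eigMat_false_inl, eigMat_false_inr]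
      calc _ = 2⁻¹ * ∑ p, eigMat k false p (parent k j) * eigMat k false p (parent k l) +
            2⁻¹ * (altSign k j * altSign k l) *
              ∑ p, eigMat k true p (parent k j) * eigMat k true p (parent k l) := by
            rw [Finset.mul_sum, Finset.mul_sum, ← h2]
            congr 1 <;> refine Finset.sum_congr rfl fun p _ => by ring
        _ = _ := by rw [e, e]; ring
    · simp only [Matrix.transpose_apply, eigMat_true_inl, eigMat_true_inr]
      calc _ = 2⁻¹ * (altSign k j * altSign k l) *
              ∑ p, eigMat k true p (parent k j) * eigMat k true p (parent k l) +
            2⁻¹ * ∑ p, eigMat k false p (parent k j) * eigMat k false p (parent k l) := by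
            rw [Finset.mul_sum, Finset.mul_sum, ← h2]
            congr 1 <;> refine Finset.sum_congr rfl fun p _ => by ring
        _ = _ := by rw [e, e]; ring

theorem eigMat_mem_unitaryGroup (k : ℕ) (i : Bool) :
    eigMat k i ∈ Matrix.unitaryGroup (Idx k) ℂ := by
  rw [Matrix.mem_unitaryGroup_iff', Matrix.star_eq_conjTranspose, conjTranspose_eigMat,
    transpose_mul_eigMat]

/-! ### The partitions -/

theorem partMat_mul_transpose (k : ℕ) (i : Bool) : partMat k i * (partMat k i)ᵀ = 1 := by
  induction k generalizing i with
  | zero =>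
    ext a b
    cases i <;> simp [partMat, Matrix.mul_apply]
  | succ k ih =>
    cases i
    · simp only [partMat, Matrix.fromBlocks_transpose, Matrix.fromBlocks_multiply, ih]
      simp [← Matrix.fromBlocks_one]
    · simp only [partMat, Matrix.transpose_neg, Matrix.fromBlocks_transpose,
        Matrix.fromBlocks_multiply, Matrix.neg_mul, Matrix.mul_neg, neg_neg, ih]
      simp [← Matrix.fromBlocks_one]

theorem partMat_mul_transpose_not (k : ℕ) (i : Bool) : partMat k i * (partMat k (!i))ᵀ = 0 := by
  induction k generalizing i with
  | zero =>
    ext a b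
    cases i <;> simp [partMat, Matrix.mul_apply]
  | succ k ih =>
    have h0 := ih false
    have h1 := ih true
    simp only [Bool.not_false, Bool.not_true] at h0 h1
    cases i
    · simp only [partMat, Bool.not_false, Matrix.transpose_neg, Matrix.fromBlocks_transpose,
        Matrix.fromBlocks_multiply, Matrix.mul_neg, h0, h1]
      simp
    · simp only [partMat, Bool.not_true, Matrix.fromBlocks_transpose,
        Matrix.fromBlocks_multiply, Matrix.neg_mul, h0, h1]
      simp

theorem sum_transpose_mul_partMat (k : ℕ) :
    (partMat k false)ᵀ * partMat k false + (partMat k true)ᵀ * partMat k true = 1 := by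
  induction k with
  | zero =>
    ext a b
    rcases a with a | a <;> rcases b with b | b <;>
      simp [partMat, Matrix.mul_apply]
  | succ k ih =>
    simp only [partMat, Matrix.transpose_neg, Matrix.fromBlocks_transpose,
      Matrix.fromBlocks_multiply, Matrix.neg_mul, Matrix.mul_neg, neg_neg,
      Matrix.fromBlocks_add]
    simp [ih, add_comm ((partMat k true)ᵀ * partMat k true)]

theorem partMat_false_mulVec (k : ℕ) (s : Idx (k + 2) → ℂ) :
    partMat (k + 1) false *ᵥ s =
      Sum.elim (partMat k false *ᵥ fun j => s (Sum.inl j))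
        (partMat k true *ᵥ fun j => s (Sum.inr j)) := by
  rw [partMat]
  ext j
  rcases j with j | j <;>
    simp [Matrix.fromBlocks_mulVec, Function.comp_def]

theorem partMat_true_mulVec (k : ℕ) (s : Idx (k + 2) → ℂ) :
    partMat (k + 1) true *ᵥ s =
      -Sum.elim (partMat k true *ᵥ fun j => s (Sum.inl j))
        (partMat k false *ᵥ fun j => s (Sum.inr j)) := by
  rw [partMat]
  ext j
  rcases j with j | j <;>
    simp [Matrix.neg_mulVec, Matrix.fromBlocks_mulVec, Function.comp_def]

theorem partMat_mulVec_partition (k : ℕ) (i : Bool) (s : Idx (k + 1) → ℂ) :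
    partMat k i *ᵥ partition (k + 1) i s = partMat k i *ᵥ s := by
  induction k generalizing i with
  | zero =>
    ext a
    cases i <;> simp [partMat, partition, Matrix.mulVec, dotProduct]
  | succ k ih =>
    cases i
    · rw [partMat_false_mulVec, partMat_false_mulVec]
      exact congrArg₂ Sum.elim (ih false fun j => s (Sum.inl j)) (ih true fun j => s (Sum.inr j))
    · rw [partMat_true_mulVec, partMat_true_mulVec]
      exact congrArg Neg.neg
        (congrArg₂ Sum.elim (ih true fun j => s (Sum.inl j)) (ih false fun j => s (Sum.inr j)))

theorem partMat_mulVec_partition_not (k : ℕ) (i : Bool) (s : Idx (k + 1) → ℂ) :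
    partMat k (!i) *ᵥ partition (k + 1) i s = 0 := by
  induction k generalizing i with
  | zero =>
    ext a
    cases i <;> simp [partMat, partition, Matrix.mulVec, dotProduct]
  | succ k ih =>
    have h0 := ih false
    have h1 := ih true
    simp only [Bool.not_false, Bool.not_true] at h0 h1
    cases i
    · rw [Bool.not_false, partMat_true_mulVec]
      refine neg_eq_zero.2 ?_
      refine Eq.trans (congrArg₂ Sum.elim (h0 fun j => s (Sum.inl j))
        (h1 fun j => s (Sum.inr j))) ?_
      ext a
      rcases a with a | a <;> rfl
    · rw [Bool.not_true, partMat_false_mulVec]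
      refine Eq.trans (congrArg₂ Sum.elim (h1 fun j => s (Sum.inl j))
        (h0 fun j => s (Sum.inr j))) ?_
      ext a
      rcases a with a | a <;> rfl

/-! ### The eigenbasis turns code matrices into direct sums of quaternions -/

/-- The coordinates `W_{L,i}ᵀ v_{L,i}(s)` of the partition `i` of `s` in the eigenbasis. -/
noncomputable def eigCoord (k : ℕ) (i : Bool) (s : Idx (k + 1) → ℂ) : Idx k → ℂ :=
  (eigMat k i)ᵀ *ᵥ (partMat k i *ᵥ s)

theorem eigCoord_add (k : ℕ) (i : Bool) (s t : Idx (k + 1) → ℂ) :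
    eigCoord k i (s + t) = eigCoord k i s + eigCoord k i t := by
  simp only [eigCoord, Matrix.mulVec_add]

theorem eigCoord_neg (k : ℕ) (i : Bool) (s : Idx (k + 1) → ℂ) :
    eigCoord k i (-s) = -eigCoord k i s := by
  simp only [eigCoord, Matrix.mulVec_neg]

theorem eigCoord_zero_false (s : Idx 1 → ℂ) (j : Idx 0) : eigCoord 0 false s j = s (Sum.inl ()) := by
  simp [eigCoord, eigMat, partMat, Matrix.mulVec, dotProduct]

theorem eigCoord_zero_true (s : Idx 1 → ℂ) (j : Idx 0) : eigCoord 0 true s j = -s (Sum.inr ()) := by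
  simp [eigCoord, eigMat, partMat, Matrix.mulVec, dotProduct]

theorem eigCoord_succ_false (k : ℕ) (s : Idx (k + 2) → ℂ) (j : Idx (k + 1)) :
    eigCoord (k + 1) false s j = ((Real.sqrt 2 : ℝ) : ℂ)⁻¹ *
      (eigCoord k false (fun p => s (Sum.inl p)) (parent k j) +
        altSign k j * eigCoord k true (fun p => s (Sum.inr p)) (parent k j)) := by
  rw [eigCoord, partMat_false_mulVec]
  refine (sum_idx_succ k _).trans ?_
  simp only [Matrix.transpose_apply, eigMat_false_inl, eigMat_false_inr, Sum.elim_inl,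
    Sum.elim_inr, eigCoord]
  rw [mul_add]
  refine congrArg₂ (· + ·) ?_ ?_
  · simp only [mul_assoc, ← Finset.mul_sum]
    rfl
  · simp only [mul_assoc, ← Finset.mul_sum]
    rfl

/-- The minus sign in v_{2M,2} cancels the one in the column (b; -a), so the right half of s enters
with a plus sign. -/
theorem eigCoord_succ_true (k : ℕ) (s : Idx (k + 2) → ℂ) (j : Idx (k + 1)) :
    eigCoord (k + 1) true s j = ((Real.sqrt 2 : ℝ) : ℂ)⁻¹ *
      (eigCoord k false (fun p => s (Sum.inr p)) (parent k j) -
        altSign k j * eigCoord k true (fun p => s (Sum.inl p)) (parent k j)) := by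
  rw [eigCoord, partMat_true_mulVec, Matrix.mulVec_neg]
  refine (congrArg Neg.neg (sum_idx_succ k _)).trans ?_
  simp only [Matrix.transpose_apply, eigMat_true_inl, eigMat_true_inr, Sum.elim_inl,
    Sum.elim_inr, eigCoord]
  rw [mul_sub, neg_add, sub_eq_neg_add]
  refine congrArg₂ (· + ·) (congrArg Neg.neg ?_) ?_
  · simp only [mul_assoc, ← Finset.mul_sum]
    rfl
  · simp only [mul_assoc, ← Finset.mul_sum, mul_neg, neg_mul, Finset.sum_neg_distrib, neg_neg]
    rfl

theorem eigCoord_star (k : ℕ) (i : Bool) (s : Idx (k + 1) → ℂ) (j : Idx k) :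
    eigCoord k i (fun p => star (s p)) j = star (eigCoord k i s j) := by
  induction k generalizing i with
  | zero => cases i <;> simp [eigCoord_zero_false, eigCoord_zero_true]
  | succ k ih =>
    cases i
    · rw [eigCoord_succ_false, eigCoord_succ_false, ih false fun p => s (Sum.inl p),
        ih true fun p => s (Sum.inr p)]
      simp only [star_mul', star_add, star_inv₀, star_sqrt_two, star_altSign]
    · rw [eigCoord_succ_true, eigCoord_succ_true, ih true fun p => s (Sum.inl p),
        ih false fun p => s (Sum.inr p)]
      simp only [star_mul', star_sub, star_inv₀, star_sqrt_two, star_altSign]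

theorem codeMatrix_mulVec_inl (k : ℕ) (s h : Idx (k + 1) → ℂ) :
    (fun p => (codeMatrix (k + 1) s *ᵥ h) (Sum.inl p)) =
      (codeMatrix k fun j => s (Sum.inl j)) *ᵥ (fun j => h (Sum.inl j)) +
        (codeMatrix k fun j => s (Sum.inr j)) *ᵥ (fun j => h (Sum.inr j)) := by
  ext p
  rw [codeMatrix, Matrix.fromBlocks_mulVec]
  rfl

theorem codeMatrix_mulVec_inr (k : ℕ) (s h : Idx (k + 1) → ℂ) :
    (fun p => (codeMatrix (k + 1) s *ᵥ h) (Sum.inr p)) =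
      -((codeMatrix k fun j => star (s (Sum.inr j))) *ᵥ (fun j => h (Sum.inl j))) +
        (codeMatrix k fun j => star (s (Sum.inl j))) *ᵥ (fun j => h (Sum.inr j)) := by
  ext p
  rw [codeMatrix, Matrix.fromBlocks_mulVec, Matrix.neg_mulVec]
  rfl

/-- For k = 0 this is the Alamouti scheme. The block recursion of G and the passage from `parent k
j` to `j` are compatible, so the quaternion product is inherited at each doubling. -/
theorem eigCoord_codeMatrix (k : ℕ) (s h : Idx (k + 1) → ℂ) (j : Idx k) :
    eigCoord k false (codeMatrix (k + 1) s *ᵥ h) j = ((Real.sqrt 2 : ℝ) : ℂ) ^ k *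
        (eigCoord k false s j * eigCoord k false h j +
          eigCoord k true s j * eigCoord k true h j) ∧
      eigCoord k true (codeMatrix (k + 1) s *ᵥ h) j = ((Real.sqrt 2 : ℝ) : ℂ) ^ k *
        (star (eigCoord k false s j) * eigCoord k true h j -
          star (eigCoord k true s j) * eigCoord k false h j) := by
  induction k with
  | zero =>
    have hl := congrFun (codeMatrix_mulVec_inl 0 s h) ()
    have hr := congrFun (codeMatrix_mulVec_inr 0 s h) ()
    simp only [codeMatrix, Matrix.mulVec, dotProduct] at hl hr
    simp only [eigCoord_zero_false, eigCoord_zero_true]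
    simp [codeMatrix, Matrix.mulVec, dotProduct]
  | succ k ih =>
    have hs := sqrt_two_ne_zero
    let l (f : Idx (k + 2) → ℂ) : Idx (k + 1) → ℂ := fun p => f (Sum.inl p)
    let r (f : Idx (k + 2) → ℂ) : Idx (k + 1) → ℂ := fun p => f (Sum.inr p)
    have el (i : Bool) : eigCoord k i (l (codeMatrix (k + 2) s *ᵥ h)) (parent k j) =
        eigCoord k i (codeMatrix (k + 1) (l s) *ᵥ l h) (parent k j) +
          eigCoord k i (codeMatrix (k + 1) (r s) *ᵥ r h) (parent k j) :=
      congrFun ((congrArg (eigCoord k i) (codeMatrix_mulVec_inl (k + 1) s h)).trans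
        (eigCoord_add k i _ _)) _
    have er (i : Bool) : eigCoord k i (r (codeMatrix (k + 2) s *ᵥ h)) (parent k j) =
        -eigCoord k i ((codeMatrix (k + 1) fun j => star (r s j)) *ᵥ l h) (parent k j) +
          eigCoord k i ((codeMatrix (k + 1) fun j => star (l s j)) *ᵥ r h) (parent k j) :=
      congrFun ((congrArg (eigCoord k i) (codeMatrix_mulVec_inr (k + 1) s h)).trans
        ((eigCoord_add k i _ _).trans (congrArg (· + _) (eigCoord_neg k i _)))) _
    simp only [eigCoord_succ_false, eigCoord_succ_true]
    change _ * (eigCoord k false (l (codeMatrix (k + 2) s *ᵥ h)) _ +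
        _ * eigCoord k true (r (codeMatrix (k + 2) s *ᵥ h)) _) = _ * (
        _ * (eigCoord k false (l s) _ + _ * eigCoord k true (r s) _) *
          (_ * (eigCoord k false (l h) _ + _ * eigCoord k true (r h) _)) +
        _ * (eigCoord k false (r s) _ - _ * eigCoord k true (l s) _) *
          (_ * (eigCoord k false (r h) _ - _ * eigCoord k true (l h) _))) ∧
      _ * (eigCoord k false (r (codeMatrix (k + 2) s *ᵥ h)) _ -
        _ * eigCoord k true (l (codeMatrix (k + 2) s *ᵥ h)) _) = _ * (
        star (_ * (eigCoord k false (l s) _ + _ * eigCoord k true (r s) _)) *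
          (_ * (eigCoord k false (r h) _ - _ * eigCoord k true (l h) _)) -
        star (_ * (eigCoord k false (r s) _ - _ * eigCoord k true (l s) _)) *
          (_ * (eigCoord k false (l h) _ + _ * eigCoord k true (r h) _)))
    simp only [el, er, (ih _ _ _).1, (ih _ _ _).2, eigCoord_star, star_star, star_mul', star_add,
      star_sub, star_inv₀, star_sqrt_two, star_altSign]
    -- The powers of √2 balance on both sides, so its value no longer matters, only that it is
    -- nonzero; the signs enter through their square being 1.
    generalize ((Real.sqrt 2 : ℝ) : ℂ) = c at *
    rcases altSign_eq k j with h1 | h1 <;> rw [h1] <;> constructor <;> field_simp <;> ring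

/-! ### Norm identities and the kernel of a code matrix -/

theorem sum_norm_sq_mulVec {m n : Type*} [Fintype m] [Fintype n] (U : Matrix m n ℂ) (s : n → ℂ) :
    ((∑ j, ‖(U *ᵥ s) j‖ ^ 2 : ℝ) : ℂ) = star s ⬝ᵥ ((Uᴴ * U) *ᵥ s) := by
  rw [← Matrix.mulVec_mulVec, Matrix.dotProduct_mulVec, ← Matrix.star_mulVec, dotProduct]
  push_cast
  exact Finset.sum_congr rfl fun j _ => (Complex.conj_mul' _).symm

theorem conjTranspose_partMat (k : ℕ) (i : Bool) : (partMat k i)ᴴ = (partMat k i)ᵀ := by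
  induction k generalizing i with
  | zero =>
    ext a b
    cases i <;> rcases a with a | a <;> simp [partMat]
  | succ k ih =>
    cases i <;> simp [partMat, Matrix.fromBlocks_conjTranspose, Matrix.fromBlocks_transpose, ih]

/-- Parseval: each W is orthogonal, and the two partitions together exhaust the vector. -/
theorem sum_norm_sq_eigCoord (k : ℕ) (s : Idx (k + 1) → ℂ) :
    ∑ j, (‖eigCoord k false s j‖ ^ 2 + ‖eigCoord k true s j‖ ^ 2) = ∑ p, ‖s p‖ ^ 2 := by
  have e (i : Bool) : ((∑ j, ‖eigCoord k i s j‖ ^ 2 : ℝ) : ℂ) =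
      star s ⬝ᵥ (((partMat k i)ᵀ * partMat k i) *ᵥ s) := by
    have hu : eigMat k i * (eigMat k i)ᵀ = 1 := mul_eq_one_comm.1 (transpose_mul_eigMat k i)
    have ht : ((eigMat k i)ᵀ)ᴴ = eigMat k i := by
      rw [← conjTranspose_eigMat, Matrix.conjTranspose_conjTranspose]
    rw [eigCoord, Matrix.mulVec_mulVec, sum_norm_sq_mulVec, Matrix.conjTranspose_mul, ht,
      conjTranspose_partMat, Matrix.mul_assoc, ← Matrix.mul_assoc (eigMat k i), hu,
      Matrix.one_mul]
  have e1 := sum_norm_sq_mulVec (1 : Matrix (Idx (k + 1)) (Idx (k + 1)) ℂ) s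
  rw [Matrix.one_mulVec, Matrix.conjTranspose_one, Matrix.one_mul] at e1
  apply Complex.ofReal_injective
  rw [e1, Finset.sum_add_distrib, Complex.ofReal_add, e, e, ← dotProduct_add, ← Matrix.add_mulVec,
    sum_transpose_mul_partMat]

/-- The squared norm of the quaternion with index `j` in the decomposition of `G[s]`. -/
noncomputable def eigNorm (k : ℕ) (s : Idx (k + 1) → ℂ) (j : Idx k) : ℝ :=
  ‖eigCoord k false s j‖ ^ 2 + ‖eigCoord k true s j‖ ^ 2

theorem eigNorm_nonneg (k : ℕ) (s : Idx (k + 1) → ℂ) (j : Idx k) : 0 ≤ eigNorm k s j := by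
  unfold eigNorm
  positivity

theorem eigNorm_eq_zero_iff {k : ℕ} {s : Idx (k + 1) → ℂ} {j : Idx k} :
    eigNorm k s j = 0 ↔ ∀ i, eigCoord k i s j = 0 := by
  rw [eigNorm, add_eq_zero_iff_of_nonneg (by positivity) (by positivity)]
  simp [Bool.forall_bool]

/-- The matrix with rows (a, b) and (-b^*, a^*) has orthogonal columns of equal norm. -/
theorem norm_sq_quaternion_mul (a b c d : ℂ) :
    ‖a * c + b * d‖ ^ 2 + ‖star a * d - star b * c‖ ^ 2 =
      (‖a‖ ^ 2 + ‖b‖ ^ 2) * (‖c‖ ^ 2 + ‖d‖ ^ 2) := by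
  simp only [Complex.sq_norm, Complex.normSq_apply, Complex.star_def, Complex.add_re,
    Complex.add_im, Complex.sub_re, Complex.sub_im, Complex.mul_re, Complex.mul_im,
    Complex.conj_re, Complex.conj_im]
  ring

theorem eigNorm_codeMatrix_mulVec (k : ℕ) (s h : Idx (k + 1) → ℂ) (j : Idx k) :
    eigNorm k (codeMatrix (k + 1) s *ᵥ h) j = 2 ^ k * eigNorm k s j * eigNorm k h j := by
  have hc : ‖((Real.sqrt 2 : ℝ) : ℂ) ^ k‖ ^ 2 = 2 ^ k := by
    rw [norm_pow, Complex.norm_real, Real.norm_of_nonneg (Real.sqrt_nonneg 2), ← pow_mul,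
      mul_comm, pow_mul, Real.sq_sqrt (by norm_num)]
  rw [eigNorm, (eigCoord_codeMatrix k s h j).1, (eigCoord_codeMatrix k s h j).2, norm_mul,
    norm_mul _ (_ - _), mul_pow, mul_pow, ← mul_add, norm_sq_quaternion_mul, hc, mul_assoc]
  rfl

theorem sum_norm_sq_codeMatrix_mulVec (k : ℕ) (s h : Idx (k + 1) → ℂ) :
    ∑ t, ‖(codeMatrix (k + 1) s *ᵥ h) t‖ ^ 2 = ∑ j, 2 ^ k * eigNorm k s j * eigNorm k h j := by
  rw [← sum_norm_sq_eigCoord]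
  exact Finset.sum_congr rfl fun j _ => eigNorm_codeMatrix_mulVec k s h j

/-- A sum of nonnegative terms vanishes only termwise. All rank estimates rest on this description
of the kernel. -/
theorem codeMatrix_mulVec_eq_zero_iff {k : ℕ} {s h : Idx (k + 1) → ℂ} :
    codeMatrix (k + 1) s *ᵥ h = 0 ↔ ∀ j, eigNorm k s j = 0 ∨ eigNorm k h j = 0 := by
  have hz : codeMatrix (k + 1) s *ᵥ h = 0 ↔ ∑ t, ‖(codeMatrix (k + 1) s *ᵥ h) t‖ ^ 2 = 0 := by
    rw [Finset.sum_eq_zero_iff_of_nonneg fun t _ => by positivity]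
    simp [funext_iff]
  rw [hz, sum_norm_sq_codeMatrix_mulVec, Finset.sum_eq_zero_iff_of_nonneg fun j _ =>
    mul_nonneg (mul_nonneg (by positivity) (eigNorm_nonneg k s j)) (eigNorm_nonneg k h j)]
  simp

theorem eigNorm_partition (k : ℕ) (i : Bool) (s : Idx (k + 1) → ℂ) (j : Idx k) :
    eigNorm k (partition (k + 1) i s) j = ‖eigCoord k i s j‖ ^ 2 := by
  have h1 := partMat_mulVec_partition k i s
  have h2 := partMat_mulVec_partition_not k i s
  cases i <;> simp only [Bool.not_false, Bool.not_true] at h2 <;>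
    simp [eigNorm, eigCoord, h1, h2]

theorem exists_eigenvalues_equivalent_channel (k : ℕ) (i : Bool) (h : Idx (k + 1) → ℂ) :
    ∃ lam : Idx k → ℝ, (∀ j, 0 ≤ lam j) ∧ ∀ s : Idx (k + 1) → ℂ,
      ∑ t, ‖(codeMatrix (k + 1) (partition (k + 1) i s)).mulVec h t‖ ^ 2 =
        ∑ j, lam j * ‖(eigMat k i).conjTranspose.mulVec ((partMat k i).mulVec s) j‖ ^ 2 := by
  -- The eigenvalues are the quaternion norms of h, the same for both partitions.
  refine ⟨fun j => 2 ^ k * eigNorm k h j,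
    fun j => mul_nonneg (by positivity) (eigNorm_nonneg k h j), fun s => ?_⟩
  rw [sum_norm_sq_codeMatrix_mulVec]
  refine Finset.sum_congr rfl fun j _ => ?_
  rw [eigNorm_partition, conjTranspose_eigMat, ← eigCoord]
  ring

/-! ### Blocks of the precoder -/

/-- The index of the diagonal block of `blockW k r` that contains `j`. -/
def blk : (k r : ℕ) → Idx k → Idx r
  | _, 0, _ => ()
  | 0, r + 1, j => Sum.inl (blk 0 r j)
  | k + 1, r + 1, Sum.inl j => Sum.inl (blk k r j)
  | k + 1, r + 1, Sum.inr j => Sum.inr (blk k r j)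

/-- The block is given by the first r bits, and for r ≤ k the last of the k + 1 bits is not among
them. -/
theorem blk_succ (k r : ℕ) (h : r ≤ k) (j : Idx (k + 1)) :
    blk (k + 1) r j = blk k r (parent k j) := by
  induction r generalizing k with
  | zero => cases k <;> rfl
  | succ r ih =>
    obtain ⟨k, rfl⟩ : ∃ m, k = m + 1 := ⟨k - 1, by omega⟩
    rcases j with j | j
    · exact congrArg Sum.inl (ih k (by omega) j)
    · exact congrArg Sum.inr (ih k (by omega) j)

theorem blk_self (r : ℕ) (j : Idx r) : blk r r j = j := by
  induction r with
  | zero => rfl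
  | succ r ih =>
    rcases j with j | j
    · exact congrArg Sum.inl (ih j)
    · exact congrArg Sum.inr (ih j)

theorem card_blk_eq (k r : ℕ) (h : r ≤ k) (β : Idx r) :
    (Finset.univ.filter fun j : Idx k => blk k r j = β).card = 2 ^ (k - r) := by
  induction k, h using Nat.le_induction with
  | base => simp [blk_self, Finset.filter_eq']
  | succ k h ih =>
    rw [Finset.card_filter] at ih ⊢
    simp only [blk_succ k r h]
    rw [sum_parent_altSign k fun j _ => if blk k r j = β then 1 else 0, Finset.sum_add_distrib, ih,
      Nat.succ_sub h, pow_succ, mul_two]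

theorem blockW_zero (k : ℕ) : blockW k 0 = eigMat k false := by
  cases k <;> rfl

theorem blockW_ne_zero_iff (k r : ℕ) (h : r ≤ k) (p q : Idx k) :
    blockW k r p q ≠ 0 ↔ blk k r p = blk k r q := by
  induction r generalizing k with
  | zero =>
    rw [blockW_zero]
    exact iff_of_true (eigMat_ne_zero k false p q) rfl
  | succ r ih =>
    obtain ⟨k, rfl⟩ : ∃ m, k = m + 1 := ⟨k - 1, by omega⟩
    rcases p with p | p <;> rcases q with q | q
    · exact (ih k (by omega) p q).trans Sum.inl_injective.eq_iff.symm
    · exact iff_of_false (fun h => h rfl) (fun h => by cases h)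
    · exact iff_of_false (fun h => h rfl) (fun h => by cases h)
    · exact (ih k (by omega) p q).trans Sum.inr_injective.eq_iff.symm

theorem blockW_mul_conjTranspose (k r : ℕ) (h : r ≤ k) : blockW k r * (blockW k r)ᴴ = 1 := by
  induction r generalizing k with
  | zero =>
    rw [blockW_zero, conjTranspose_eigMat]
    exact mul_eq_one_comm.1 (transpose_mul_eigMat k false)
  | succ r ih =>
    obtain ⟨k, rfl⟩ : ∃ m, k = m + 1 := ⟨k - 1, by omega⟩
    rw [blockW, Matrix.fromBlocks_conjTranspose, Matrix.fromBlocks_multiply]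
    simp [ih k (by omega), ← Matrix.fromBlocks_one]

/-- The two summands act on orthogonal partition subspaces: mixed products die because the rows of
different `partMat` are orthogonal, and the diagonal ones add up to 1. -/
theorem precoder_mul_conjTranspose (k r : ℕ) (h : r ≤ k) (θ : Idx (k + 1) → ℝ) :
    precoder k (r + 1) θ * (precoder k (r + 1) θ)ᴴ = 1 := by
  have hd : Matrix.diagonal (fun j => Complex.exp (Complex.I * (θ j : ℂ))) *
      (Matrix.diagonal fun j => Complex.exp (Complex.I * (θ j : ℂ)))ᴴ = 1 := by
    rw [Matrix.diagonal_conjTranspose, Matrix.diagonal_mul_diagonal, ← Matrix.diagonal_one]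
    congr 1
    ext j
    rw [Pi.star_apply, Complex.star_def, Complex.mul_conj', mul_comm, Complex.norm_exp_ofReal_mul_I]
    norm_num
  have hi (i j : Bool) : (partMat k i)ᵀ * eigMat k i * blockW k r * partMat k i *
      ((partMat k j)ᵀ * eigMat k j * blockW k r * partMat k j)ᴴ =
      if i = j then (partMat k i)ᵀ * partMat k i else 0 := by
    have hb := blockW_mul_conjTranspose k r h
    have hu : eigMat k i * (eigMat k i)ᵀ = 1 := mul_eq_one_comm.1 (transpose_mul_eigMat k i)
    have ht : (partMat k j)ᵀᴴ = partMat k j := by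
      rw [← conjTranspose_partMat, Matrix.conjTranspose_conjTranspose]
    rw [Matrix.conjTranspose_mul, Matrix.conjTranspose_mul, Matrix.conjTranspose_mul,
      conjTranspose_partMat, conjTranspose_eigMat, ht]
    split_ifs with hij
    · subst hij
      calc _ = (partMat k i)ᵀ * (eigMat k i * (blockW k r * (partMat k i * (partMat k i)ᵀ) *
            (blockW k r)ᴴ) * (eigMat k i)ᵀ) * partMat k i := by simp only [Matrix.mul_assoc]
        _ = _ := by rw [partMat_mul_transpose, Matrix.mul_one, hb, Matrix.mul_one, hu,
            Matrix.mul_one]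
    · obtain rfl : j = !i := by cases i <;> cases j <;> simp_all
      calc _ = (partMat k i)ᵀ * (eigMat k i * (blockW k r * (partMat k i * (partMat k !i)ᵀ) *
            (blockW k r)ᴴ) * (eigMat k !i)ᵀ) * partMat k !i := by simp only [Matrix.mul_assoc]
        _ = _ := by rw [partMat_mul_transpose_not, Matrix.mul_zero, Matrix.zero_mul,
            Matrix.mul_zero, Matrix.zero_mul, Matrix.mul_zero, Matrix.zero_mul]
  rw [precoder, Nat.add_sub_cancel, Matrix.conjTranspose_mul, Matrix.mul_assoc,
    ← Matrix.mul_assoc (Matrix.diagonal _), hd, Matrix.one_mul, Matrix.conjTranspose_sum,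
    Finset.sum_mul_sum]
  simp only [hi, Finset.sum_ite_eq, Finset.mem_univ, if_true]
  rw [Fintype.sum_bool]
  exact (add_comm _ _).trans (sum_transpose_mul_partMat k)

theorem eigCoord_precoder_mulVec (k r : ℕ) (i : Bool) (θ : Idx (k + 1) → ℝ) (c : Idx (k + 1) → ℂ) :
    eigCoord k i (precoder k (r + 1) θ *ᵥ c) =
      blockW k r *ᵥ (partMat k i *ᵥ fun p => Complex.exp (Complex.I * (θ p : ℂ)) * c p) := by
  have hd : Matrix.diagonal (fun j => Complex.exp (Complex.I * (θ j : ℂ))) *ᵥ c =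
      fun p => Complex.exp (Complex.I * (θ p : ℂ)) * c p := by
    ext p
    rw [Matrix.mulVec_diagonal]
  -- Here `y` collects the contribution of the other partition, which `partMat k i` annihilates.
  have hp (i : Bool) (x y : Matrix (Idx k) (Idx (k + 1)) ℂ) : (eigMat k i)ᵀ * (partMat k i *
      ((partMat k i)ᵀ * (eigMat k i * x) + (partMat k !i)ᵀ * y)) = x := by
    rw [Matrix.mul_add, ← Matrix.mul_assoc (partMat k i), ← Matrix.mul_assoc (partMat k i),
      partMat_mul_transpose, partMat_mul_transpose_not, Matrix.one_mul, Matrix.zero_mul, add_zero,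
      ← Matrix.mul_assoc, transpose_mul_eigMat, Matrix.one_mul]
  rw [precoder, Nat.add_sub_cancel, ← Matrix.mulVec_mulVec, hd, eigCoord, Matrix.mulVec_mulVec,
    Matrix.mulVec_mulVec, Matrix.mulVec_mulVec, Fintype.sum_bool]
  congr 1
  simp only [Matrix.mul_assoc]
  cases i
  · exact (congrArg (fun z => (eigMat k false)ᵀ * (partMat k false * z)) (add_comm _ _)).trans
      (hp false _ _)
  · exact hp true _ _

theorem nonempty_idx (k : ℕ) : Nonempty (Idx k) :=
  Fintype.card_pos_iff.1 (by rw [card_idx]; positivity)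

/-! ### Positions of the symbols of a partition -/

/-- The position in `s` of the `j`-th coordinate of `v_{L,i}(s)`. -/
def slot : (k : ℕ) → Bool → Idx k → Idx (k + 1)
  | 0, false, _ => Sum.inl ()
  | 0, true, _ => Sum.inr ()
  | k + 1, i, Sum.inl j => Sum.inl (slot k i j)
  | k + 1, i, Sum.inr j => Sum.inr (slot k (!i) j)

/-- Each row of `partMat` selects one entry up to sign; only the nonvanishing of that sign is needed
later. -/
theorem exists_partMat_mulVec (k : ℕ) (i : Bool) (j : Idx k) :
    ∃ ε : ℂ, ε ≠ 0 ∧ ∀ s, (partMat k i *ᵥ s) j = ε * s (slot k i j) := by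
  induction k generalizing i with
  | zero =>
    cases i
    · exact ⟨1, one_ne_zero, fun s => by simp [partMat, slot, Matrix.mulVec, dotProduct]⟩
    · exact ⟨-1, by norm_num, fun s => by simp [partMat, slot, Matrix.mulVec, dotProduct]⟩
  | succ k ih =>
    cases i <;> rcases j with j | j
    · obtain ⟨ε, hε, h⟩ := ih false j
      exact ⟨ε, hε, fun s => (congrFun (partMat_false_mulVec k s) _).trans (h _)⟩
    · obtain ⟨ε, hε, h⟩ := ih true j
      exact ⟨ε, hε, fun s => (congrFun (partMat_false_mulVec k s) _).trans (h _)⟩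
    · obtain ⟨ε, hε, h⟩ := ih true j
      exact ⟨-ε, neg_ne_zero.2 hε, fun s => (congrFun (partMat_true_mulVec k s) _).trans
        ((congrArg Neg.neg (h _)).trans (neg_mul _ _).symm)⟩
    · obtain ⟨ε, hε, h⟩ := ih false j
      exact ⟨-ε, neg_ne_zero.2 hε, fun s => (congrFun (partMat_true_mulVec k s) _).trans
        ((congrArg Neg.neg (h _)).trans (neg_mul _ _).symm)⟩

theorem slot_surjective (k : ℕ) (p : Idx (k + 1)) : ∃ i j, slot k i j = p := by
  induction k with
  | zero =>
    rcases p with p | p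
    · exact ⟨false, (), rfl⟩
    · exact ⟨true, (), rfl⟩
  | succ k ih =>
    rcases p with p | p
    · obtain ⟨i, j, rfl⟩ := ih p
      exact ⟨i, Sum.inl j, rfl⟩
    · obtain ⟨i, j, rfl⟩ := ih p
      exact ⟨!i, Sum.inr j, by simp only [slot, Bool.not_not]⟩

/-- The positions in a vector of length `2 ^ (k + 1)` are given by a partition and the position in
that partition. -/
noncomputable def slotEquiv (k : ℕ) : Bool × Idx k ≃ Idx (k + 1) :=
  Equiv.ofBijective (fun x => slot k x.1 x.2) <| by
    rw [Fintype.bijective_iff_surjective_and_card, Fintype.card_prod, card_idx, card_idx,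
      Fintype.card_bool, pow_succ, mul_comm]
    exact ⟨fun p => let ⟨i, j, h⟩ := slot_surjective k p; ⟨(i, j), h⟩, rfl⟩

theorem slot_inj {k : ℕ} {i i' : Bool} {j j' : Idx k} :
    slot k i j = slot k i' j' ↔ i = i' ∧ j = j' := by
  rw [← Prod.mk.injEq]
  exact (slotEquiv k).injective.eq_iff (a := (i, j)) (b := (i', j'))

/-- The coefficients of the eigenbasis coordinate `j` of partition `i` in terms of the rotated
symbols. -/
noncomputable def precoderCoeff (k r : ℕ) (i : Bool) (j : Idx k) (p : Idx (k + 1)) : ℂ :=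
  (blockW k r * partMat k i) j p

theorem precoderCoeff_slot_ne_zero_iff (k r : ℕ) (h : r ≤ k) (i i' : Bool) (j q : Idx k) :
    precoderCoeff k r i j (slot k i' q) ≠ 0 ↔ i = i' ∧ blk k r j = blk k r q := by
  have hs : precoderCoeff k r i j (slot k i' q) =
      ∑ x, blockW k r j x * (partMat k i *ᵥ Pi.single (slot k i' q) 1) x := by
    rw [precoderCoeff, Matrix.mul_apply]
    simp only [Matrix.mulVec_single_one, Matrix.col_apply]
  obtain ⟨ε, hε, hq⟩ := exists_partMat_mulVec k i q
  have hx (x : Idx k) (hx : slot k i x ≠ slot k i' q) :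
      (partMat k i *ᵥ Pi.single (slot k i' q) 1) x = 0 := by
    obtain ⟨δ, -, hδ⟩ := exists_partMat_mulVec k i x
    rw [hδ, Pi.single_eq_of_ne hx, mul_zero]
  rw [hs, ← blockW_ne_zero_iff k r h]
  by_cases hi : i = i'
  · subst hi
    rw [Finset.sum_eq_single q (fun x _ hxq => by
      rw [hx x fun h => hxq (slot_inj.1 h).2, mul_zero]) (fun h => absurd (Finset.mem_univ q) h),
      hq, Pi.single_eq_same, mul_one]
    simp [hε]
  · rw [Finset.sum_eq_zero fun x _ => by rw [hx x fun h => hi (slot_inj.1 h).1, mul_zero]]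
    simp [hi]

theorem eigCoord_precoder_mulVec_apply (k r : ℕ) (i : Bool) (θ : Idx (k + 1) → ℝ)
    (c : Idx (k + 1) → ℂ) (j : Idx k) :
    eigCoord k i (precoder k (r + 1) θ *ᵥ c) j =
      ∑ p, precoderCoeff k r i j p * c p * Complex.exp (Complex.I * (θ p : ℂ)) := by
  rw [eigCoord_precoder_mulVec, Matrix.mulVec_mulVec]
  refine Finset.sum_congr rfl fun p _ => ?_
  rw [precoderCoeff]
  ring

theorem eigCoord_precoder_single (k r : ℕ) (h : r ≤ k) (θ : Idx (k + 1) → ℝ) (i i' : Bool)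
    (j q : Idx k) (z : ℂ)
    (hne : eigCoord k i (precoder k (r + 1) θ *ᵥ Pi.single (slot k i' q) z) j ≠ 0) :
    i = i' ∧ blk k r j = blk k r q := by
  rw [← precoderCoeff_slot_ne_zero_iff k r h]
  intro h0
  refine hne ?_
  rw [eigCoord_precoder_mulVec_apply]
  refine Finset.sum_eq_zero fun p _ => ?_
  by_cases hp : p = slot k i' q
  · rw [hp, h0, zero_mul, zero_mul]
  · rw [Pi.single_eq_of_ne hp, mul_zero, zero_mul]

/-! ### Ranks of code matrices -/

/-- If s lives on one block, G[s] kills every h whose coordinates vanish on that block. These are 2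
· 2^(k-r) linear conditions, and rank-nullity finishes. -/
theorem rank_codeMatrix_le (k r : ℕ) (hr : r ≤ k) (s : Idx (k + 1) → ℂ) (β : Idx r)
    (h : ∀ i j, eigCoord k i s j ≠ 0 → blk k r j = β) :
    (codeMatrix (k + 1) s).rank ≤ 2 ^ (k - r + 1) := by
  let P : (Idx (k + 1) → ℂ) →ₗ[ℂ] (Bool × {j : Idx k // blk k r j = β} → ℂ) :=
    LinearMap.pi fun x => (LinearMap.proj x.2.1).comp ((eigMat k x.1)ᵀ * partMat k x.1).mulVecLin
  have hP (v : Idx (k + 1) → ℂ) (i : Bool) (j : {j : Idx k // blk k r j = β}) :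
      P v (i, j) = eigCoord k i v j.1 := by
    rw [eigCoord, Matrix.mulVec_mulVec]
    rfl
  have hker : LinearMap.ker P ≤ LinearMap.ker (codeMatrix (k + 1) s).mulVecLin := by
    intro v hv
    rw [LinearMap.mem_ker] at hv ⊢
    rw [Matrix.mulVecLin_apply, codeMatrix_mulVec_eq_zero_iff]
    intro j
    by_cases hj : blk k r j = β
    · exact Or.inr (eigNorm_eq_zero_iff.2 fun i => by rw [← hP v i ⟨j, hj⟩, hv, Pi.zero_apply])
    · exact Or.inl (eigNorm_eq_zero_iff.2 fun i => by
        by_contra hne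
        exact hj (h i j hne))
  have h1 := LinearMap.finrank_range_add_finrank_ker P
  have h2 := LinearMap.finrank_range_add_finrank_ker (codeMatrix (k + 1) s).mulVecLin
  have h3 := Submodule.finrank_mono hker
  have h4 := Submodule.finrank_le (LinearMap.range P)
  have h5 : Fintype.card (Bool × {j : Idx k // blk k r j = β}) = 2 ^ (k - r + 1) := by
    rw [Fintype.card_prod, Fintype.card_bool, Fintype.card_subtype, card_blk_eq k r hr, pow_succ,
      mul_comm]
  rw [Module.finrank_fintype_fun_eq_card, h5] at h4
  rw [Matrix.rank]
  omega

/-- One set of rows must serve both partitions and all blocks. Doubling it at each step works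
because two columns with a common parent separate the two halves of x. -/
theorem exists_rows_injective (k r : ℕ) (hr : r ≤ k) :
    ∃ F : Finset (Idx k), F.card = 2 ^ (k - r) ∧ ∀ (i : Bool) (β : Idx r) (x : Idx k → ℂ),
      (∀ p, p ∉ F → x p = 0) →
      (∀ j, blk k r j = β → ∑ p, eigMat k i p j * x p = 0) → x = 0 := by
  classical
  induction k, hr using Nat.le_induction with
  -- For k = r a block is a single index, so any one row will do, its entry being nonzero.
  | base =>
    obtain ⟨p0⟩ := nonempty_idx r
    refine ⟨{p0}, by simp, fun i β x hx h => ?_⟩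
    have h1 := h β (blk_self r β)
    rw [Finset.sum_eq_single p0 (fun p _ hp => by rw [hx p (by simpa using hp), mul_zero])
      (fun h => absurd (Finset.mem_univ p0) h)] at h1
    ext p
    by_cases hp : p = p0
    · subst hp
      exact (mul_eq_zero.1 h1).resolve_left (eigMat_ne_zero r i p β)
    · exact hx p (by simpa using hp)
  | succ k hr ih =>
    obtain ⟨F, hF, hi⟩ := ih
    refine ⟨F.disjSum F, by rw [Finset.card_disjSum, hF, Nat.succ_sub hr, pow_succ, mul_two],
      fun i β x hx h => ?_⟩
    -- The half-sum and half-difference of the equations for the two children of `j` isolate the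
    -- halves of x, one paired with partition `i` and the other with `!i`.
    have hsplit (j : Idx k) (hj : blk k r j = β) :
        ∑ p, eigMat k i p j * x (Sum.inl p) = 0 ∧ ∑ p, eigMat k (!i) p j * x (Sum.inr p) = 0 := by
      obtain ⟨⟨l₁, hp₁, hs₁⟩, ⟨l₂, hp₂, hs₂⟩⟩ := exists_parent_altSign k j
      have e₁ := h l₁ (by rw [blk_succ k r hr, hp₁, hj])
      have e₂ := h l₂ (by rw [blk_succ k r hr, hp₂, hj])
      rw [sum_idx_succ] at e₁ e₂
      cases i
      · simp only [eigMat_false_inl, eigMat_false_inr, hp₁, hs₁, hp₂, hs₂, one_mul, neg_mul,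
          mul_neg, Finset.sum_neg_distrib, mul_assoc, ← Finset.mul_sum] at e₁ e₂
        have e₃ := (mul_eq_zero.1 ((mul_add _ _ _).trans e₁)).resolve_left
          (inv_ne_zero sqrt_two_ne_zero)
        have e₄ := (mul_eq_zero.1 ((mul_sub _ _ _).trans ((sub_eq_add_neg _ _).trans e₂))).resolve_left
          (inv_ne_zero sqrt_two_ne_zero)
        exact ⟨by linear_combination (e₃ + e₄) / 2, by
          rw [Bool.not_false]
          linear_combination (e₃ - e₄) / 2⟩
      · simp only [eigMat_true_inl, eigMat_true_inr, hp₁, hs₁, hp₂, hs₂, one_mul, neg_mul,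
          mul_neg, Finset.sum_neg_distrib, mul_assoc, ← Finset.mul_sum] at e₁ e₂
        have e₃ := (mul_eq_zero.1 ((mul_sub _ _ _).trans ((sub_eq_add_neg _ _).trans e₁))).resolve_left
          (inv_ne_zero sqrt_two_ne_zero)
        have e₄ := (mul_eq_zero.1 ((mul_add _ _ _).trans (neg_eq_zero.1
          ((neg_add _ _).trans e₂)))).resolve_left (inv_ne_zero sqrt_two_ne_zero)
        exact ⟨by linear_combination (e₃ + e₄) / 2, by
          rw [Bool.not_true]
          linear_combination (e₄ - e₃) / 2⟩
    have hl := hi i β (fun p => x (Sum.inl p)) (fun p hp => hx _ (by simpa using hp))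
      fun j hj => (hsplit j hj).1
    have hr' := hi (!i) β (fun p => x (Sum.inr p)) (fun p hp => hx _ (by simpa using hp))
      fun j hj => (hsplit j hj).2
    ext p
    rcases p with p | p
    · exact congrFun hl p
    · exact congrFun hr' p

theorem exists_columns_injective (k r : ℕ) (hr : r ≤ k) :
    ∃ F : Finset (Idx (k + 1)), F.card = 2 ^ (k - r + 1) ∧
      ∀ (β : Idx r) (h : Idx (k + 1) → ℂ), (∀ p, p ∉ F → h p = 0) →
        (∀ i j, blk k r j = β → eigCoord k i h j = 0) → h = 0 := by
  obtain ⟨F, hF, hi⟩ := exists_rows_injective k r hr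
  refine ⟨(Finset.univ ×ˢ F).map (slotEquiv k).toEmbedding, ?_, fun β h hh h0 => ?_⟩
  · rw [Finset.card_map, Finset.card_product, hF, Finset.card_univ, Fintype.card_bool, pow_succ,
      mul_comm]
  · ext p
    obtain ⟨i, q, rfl⟩ := slot_surjective k p
    obtain ⟨ε, hε, hq⟩ := exists_partMat_mulVec k i q
    have hz := hi i β (partMat k i *ᵥ h) (fun p hp => ?_) (h0 i)
    · have := congrFun hz q
      rw [hq] at this
      exact (mul_eq_zero.1 this).resolve_left hε
    · obtain ⟨δ, -, hδ⟩ := exists_partMat_mulVec k i p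
      rw [hδ, hh, mul_zero]
      intro hmem
      obtain ⟨⟨a, b⟩, hab, he⟩ := Finset.mem_map.1 hmem
      obtain ⟨-, rfl⟩ := slot_inj.1 he
      exact hp (Finset.mem_product.1 hab).2

/-- The columns of F are listed first, so the first min(M, |F|) selected columns lie in F whichever
of M and |F| is larger. -/
theorem exists_embedding_initial_mem {α : Type*} [Fintype α] (F : Finset α) (M : ℕ)
    (hM : M ≤ Fintype.card α) : ∃ J : Fin M ↪ α, ∀ x : Fin M, x.1 < F.card → J x ∈ F := by
  classical
  let e := (Fintype.equivFin α).symm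
  have hc : Fintype.card {x : Fin (Fintype.card α) // x.1 < F.card} =
      Fintype.card {x : Fin (Fintype.card α) // e x ∈ F} := by
    rw [Fintype.card_congr (e.subtypeEquiv (q := (· ∈ F)) fun _ => Iff.rfl), Fintype.card_coe,
      Fintype.card_subtype, Fin.card_filter_val_lt, min_eq_right (Finset.card_le_univ F)]
  let σ := (Fintype.equivOfCardEq hc).extendSubtype
  exact ⟨(Fin.castLEEmb hM).trans (σ.toEmbedding.trans e.toEmbedding), fun x hx =>
    Equiv.extendSubtype_mem (Fintype.equivOfCardEq hc) (Fin.castLE hM x) hx⟩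

/-- Dropping columns amounts to a channel that vanishes at the unused antennas, so results on the
full G[s] apply. -/
theorem mulVec_extend {m n α : Type*} [Fintype n] [Fintype α] (A : Matrix m n ℂ) (J : α ↪ n)
    (v : α → ℂ) : A *ᵥ Function.extend J v 0 = A.submatrix id J *ᵥ v := by
  ext t
  refine (Fintype.sum_of_injective J J.injective _ _ (fun p hp => ?_) fun x => ?_).symm
  · rw [Function.extend_apply' _ _ _ fun ⟨x, hx⟩ => hp ⟨x, hx⟩, Pi.zero_apply, mul_zero]
  · rw [J.injective.extend_apply]
    rfl

theorem rank_submatrix_id_le {m n α : Type*} [Fintype m] [Fintype n] [DecidableEq n] [Fintype α]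
    (A : Matrix m n ℂ) (J : α → n) : (A.submatrix id J).rank ≤ A.rank := by
  have : A.submatrix id J = A * (1 : Matrix n n ℂ).submatrix id J := by
    ext a b
    simp [Matrix.mul_apply, Matrix.one_apply]
  rw [this]
  exact Matrix.rank_mul_le_left _ _

theorem le_rank_submatrix_codeMatrix (k r : ℕ) (s : Idx (k + 1) → ℂ) (β : Idx r)
    (hs : ∀ j, blk k r j = β → eigNorm k s j ≠ 0) (F : Finset (Idx (k + 1)))
    (hF : ∀ h : Idx (k + 1) → ℂ, (∀ p, p ∉ F → h p = 0) →
      (∀ i j, blk k r j = β → eigCoord k i h j = 0) → h = 0)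
    {M : ℕ} (J : Fin M ↪ Idx (k + 1)) (hJ : ∀ x : Fin M, x.1 < F.card → J x ∈ F) :
    min M F.card ≤ ((codeMatrix (k + 1) s).submatrix id J).rank := by
  have hle : min M F.card ≤ M := min_le_left _ _
  -- Only the first min(M, |F|) columns are kept; they are independent, and the others cannot lower
  -- the rank.
  let J' : Fin (min M F.card) ↪ Idx (k + 1) := (Fin.castLEEmb hle).trans J
  have hinj : Function.Injective ((codeMatrix (k + 1) s).submatrix id J').mulVecLin := by
    rw [injective_iff_map_eq_zero]
    intro v hv
    rw [Matrix.mulVecLin_apply, ← mulVec_extend, codeMatrix_mulVec_eq_zero_iff] at hv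
    have h0 := hF (Function.extend J' v 0) (fun p hp => ?_) fun i j hj =>
      eigNorm_eq_zero_iff.1 ((hv j).resolve_left (hs j hj)) i
    · ext x
      rw [← J'.injective.extend_apply v 0 x, h0]
      rfl
    · refine Function.extend_apply' _ _ _ ?_
      rintro ⟨x, rfl⟩
      exact hp (hJ _ (x.2.trans_le (min_le_right _ _)))
  have hrank : ((codeMatrix (k + 1) s).submatrix id J').rank = min M F.card := by
    rw [Matrix.rank, LinearMap.finrank_range_of_inj hinj, Module.finrank_fin_fun]
  rw [← hrank]
  exact rank_submatrix_id_le ((codeMatrix (k + 1) s).submatrix id J) (Fin.castLE hle)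

/-! ### Generic rotations -/

/-- With angles θ_p = e(p) t for an enumeration e, each sum becomes a nonzero polynomial in exp(it).
Finitely many polynomials have finitely many roots, while the unit circle is infinite. -/
theorem exists_rotation_sum_ne_zero {ι : Type*} [Fintype ι] (S : Finset (ι → ℂ))
    (hS : ∀ w ∈ S, w ≠ 0) :
    ∃ θ : ι → ℝ, ∀ w ∈ S, ∑ p, w p * Complex.exp (Complex.I * (θ p : ℂ)) ≠ 0 := by
  classical
  let e := Fintype.equivFin ι
  let P (w : ι → ℂ) : Polynomial ℂ := ∑ p, Polynomial.monomial (e p).1 (w p)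
  have hP (w : ι → ℂ) (hw : w ≠ 0) : P w ≠ 0 := by
    obtain ⟨p, hp⟩ := Function.ne_iff.1 hw
    intro h0
    refine hp ?_
    have := congrArg (fun Q => Polynomial.coeff Q (e p).1) h0
    simpa [P, Polynomial.finsetSum_coeff, Polynomial.coeff_monomial, Fin.val_inj] using this
  have hinf : ((fun t : ℝ => Complex.exp (t * Complex.I)) '' Set.Ioc (-Real.pi) Real.pi).Infinite := by
    refine Set.Infinite.image ?_ (Set.Ioc_infinite (by linarith [Real.pi_pos]))
    intro a ha b hb hab
    have := Complex.exp_inj_of_neg_pi_lt_of_le_pi (by simpa using ha.1) (by simpa using ha.2)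
      (by simpa using hb.1) (by simpa using hb.2) hab
    exact Complex.ofReal_injective (mul_right_cancel₀ Complex.I_ne_zero this)
  obtain ⟨z, ⟨t, -, rfl⟩, hz⟩ := hinf.exists_notMem_finset (S.biUnion fun w => (P w).roots.toFinset)
  refine ⟨fun p => (e p).1 * t, fun w hw h0 => hz ?_⟩
  simp only [Finset.mem_biUnion, Multiset.mem_toFinset]
  refine ⟨w, hw, (Polynomial.mem_roots (hP w (hS w hw))).2 ?_⟩
  rw [Polynomial.IsRoot.def, ← h0]
  simp only [P, Polynomial.eval_finsetSum, Polynomial.eval_monomial]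
  refine Finset.sum_congr rfl fun p _ => ?_
  rw [← Complex.exp_nat_mul]
  push_cast
  ring_nf

/-! ### Maximum likelihood decoding by groups -/

theorem norm_sub_real_mul_sq (x y : ℂ) (a : ℝ) :
    ‖x - (a : ℂ) * y‖ ^ 2 = ‖x‖ ^ 2 - 2 * a * (star x * y).re + a ^ 2 * ‖y‖ ^ 2 := by
  simp only [Complex.sq_norm, Complex.normSq_apply, Complex.star_def, Complex.sub_re,
    Complex.sub_im, Complex.mul_re, Complex.mul_im, Complex.conj_re, Complex.conj_im,
    Complex.ofReal_re, Complex.ofReal_im]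
  ring

section General

variable {P T A R : Type} [Fintype T] [Fintype A] [Fintype R]

theorem Code.likelihood_pos (C : Code P T A) (ρ : ℝ) (H : Matrix A R ℂ) (X : Matrix T R ℂ)
    (c : P → ℂ) : 0 < C.likelihood ρ H X c :=
  Finset.prod_pos fun _ _ => Finset.prod_pos fun _ _ =>
    mul_pos (inv_pos.2 Real.pi_pos) (Real.exp_pos _)

theorem Code.log_likelihood (C : Code P T A) (ρ : ℝ) (H : Matrix A R ℂ) (X : Matrix T R ℂ)
    (c : P → ℂ) : Real.log (C.likelihood ρ H X c) =
      ∑ t, ∑ r, (Real.log Real.pi⁻¹ - ‖X t r‖ ^ 2) +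
      (∑ t, ∑ r, 2 * Real.sqrt (ρ / Fintype.card A) * (star (X t r) * (C c * H) t r).re -
        Real.sqrt (ρ / Fintype.card A) ^ 2 * ∑ r, ∑ t, ‖(C c *ᵥ H.col r) t‖ ^ 2) := by
  have hpos (t : T) (r : R) : Real.pi⁻¹ * Real.exp
      (-‖X t r - ((Real.sqrt (ρ / Fintype.card A) : ℝ) : ℂ) * (C c * H) t r‖ ^ 2) ≠ 0 :=
    (mul_pos (inv_pos.2 Real.pi_pos) (Real.exp_pos _)).ne'
  rw [Code.likelihood, Real.log_prod fun t _ => Finset.prod_ne_zero_iff.2 fun r _ => hpos t r,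
    Finset.sum_comm (s := (Finset.univ : Finset R)), Finset.mul_sum, ← Finset.sum_sub_distrib,
    ← Finset.sum_add_distrib]
  refine Finset.sum_congr rfl fun t _ => ?_
  rw [Real.log_prod fun r _ => hpos t r, Finset.mul_sum, ← Finset.sum_sub_distrib,
    ← Finset.sum_add_distrib]
  refine Finset.sum_congr rfl fun r _ => ?_
  rw [Real.log_mul (inv_ne_zero Real.pi_ne_zero) (Real.exp_ne_zero _), Real.log_exp,
    norm_sub_real_mul_sq]
  have : (C c *ᵥ H.col r) t = (C c * H) t r := rfl
  rw [this]
  ring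

/-- The symbols of the group `g`, with all other symbols replaced by zero. -/
def restrictGroup {q : ℕ} (grp : P → Fin q) (g : Fin q) (c : P → ℂ) : P → ℂ :=
  fun p => if grp p = g then c p else 0

theorem sum_restrictGroup {q : ℕ} (grp : P → Fin q) (c : P → ℂ) :
    ∑ g, restrictGroup grp g c = c := by
  ext p
  simp [restrictGroup]

/-- Changing the symbols of one group leaves all other metrics fixed, so a joint maximiser maximises
each metric; the alphabet imposes no constraint across groups. -/
theorem Code.isMLDecision_iff_of_log_likelihood_eq_sum (C : Code P T A) {q : ℕ} (ρ : ℝ)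
    (H : Matrix A R ℂ) (X : Matrix T R ℂ) (grp : P → Fin q)
    (metric : (g : Fin q) → ({p : P // grp p = g} → ℂ) → ℝ)
    (hsum : ∀ c : P → ℂ,
      Real.log (C.likelihood ρ H X c) = ∑ g, metric g (fun p => c p.1))
    (𝒜 : Finset ℂ) (c : P → ℂ) :
    C.IsMLDecision 𝒜 ρ H X c ↔ (∀ p, c p ∈ 𝒜) ∧
      ∀ (g : Fin q) (w : {p : P // grp p = g} → ℂ), (∀ p, w p ∈ 𝒜) →
        metric g w ≤ metric g (fun p => c p.1) := by
  have hle (c c' : P → ℂ) : C.likelihood ρ H X c ≤ C.likelihood ρ H X c' ↔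
      ∑ g, metric g (fun p => c p.1) ≤ ∑ g, metric g (fun p => c' p.1) := by
    rw [← hsum, ← hsum, Real.log_le_log_iff (C.likelihood_pos ρ H X c) (C.likelihood_pos ρ H X c')]
  refine and_congr_right fun hc => ⟨fun hmax g w hw => ?_,
    fun hmax c' hc' => (hle _ _).2 (Finset.sum_le_sum fun g _ => hmax g _ fun p => hc' p.1)⟩
  have h1 := (hle _ _).1 (hmax (fun p => if h : grp p = g then w ⟨p, h⟩ else c p) fun p => by
    split_ifs with h
    · exact hw ⟨p, h⟩
    · exact hc p)
  rw [← Finset.add_sum_erase _ _ (Finset.mem_univ g),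
    ← Finset.add_sum_erase _ (fun g => metric g fun p => c p.1) (Finset.mem_univ g)] at h1
  have h2 : (fun p : {p : P // grp p = g} =>
      if h : grp p.1 = g then w ⟨p.1, h⟩ else c p.1) = w := funext fun p => dif_pos p.2
  have h3 : ∀ g' ∈ Finset.univ.erase g,
      metric g' (fun p => if h : grp p.1 = g then w ⟨p.1, h⟩ else c p.1) =
        metric g' (fun p => c p.1) := fun g' hg' =>
    congrArg (metric g') (funext fun p => dif_neg (p.2.trans_ne (Finset.ne_of_mem_erase hg')))
  rw [h2, Finset.sum_congr rfl h3] at h1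
  exact le_of_add_le_add_right h1

/-- The log-likelihood is a constant plus a real-additive term minus a multiple of the energy. The
additive term splits over any grouping, so only the energy needs a hypothesis. -/
theorem Code.mlDecodesJointly_of_energy (C : Code P T A) (K q : ℕ) (hq : 0 < q) (grp : P → Fin q)
    (hcard : ∀ g, Nat.card {p : P // grp p = g} = K)
    (hadd : ∀ c c', C (c + c') = C c + C c')
    (henergy : ∀ (h : A → ℂ) (c : P → ℂ), ∑ t, ‖(C c *ᵥ h) t‖ ^ 2 =
      ∑ g, ∑ t, ‖(C (restrictGroup grp g c) *ᵥ h) t‖ ^ 2) :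
    C.MLDecodesJointly K := by
  classical
  refine ⟨q, grp, hcard, fun N ρ _ H X => ?_⟩
  let a : ℝ := Real.sqrt (ρ / Fintype.card A)
  let lin : (P → ℂ) →+ ℝ := AddMonoidHom.mk'
    (fun c => ∑ t, ∑ r, 2 * a * (star (X t r) * (C c * H) t r).re) fun c c' => by
      simp only [hadd, Matrix.add_mul, Matrix.add_apply, mul_add, Complex.add_re,
        Finset.sum_add_distrib]
  let K₀ : ℝ := ∑ t, ∑ r, (Real.log Real.pi⁻¹ - ‖X t r‖ ^ 2)
  let D (c : P → ℂ) : ℝ := lin c - a ^ 2 * ∑ r, ∑ t, ‖(C c *ᵥ H.col r) t‖ ^ 2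
  have hlog (c : P → ℂ) : Real.log (C.likelihood ρ H X c) = K₀ + D c := C.log_likelihood ρ H X c
  have hD (c : P → ℂ) : D c = ∑ g, D (restrictGroup grp g c) := by
    have hE : ∑ r, ∑ t, ‖(C c *ᵥ H.col r) t‖ ^ 2 =
        ∑ g, ∑ r, ∑ t, ‖(C (restrictGroup grp g c) *ᵥ H.col r) t‖ ^ 2 := by
      exact (Finset.sum_congr rfl fun r _ => henergy (H.col r) c).trans Finset.sum_comm
    have hL : lin c = ∑ g, lin (restrictGroup grp g c) := by
      rw [← map_sum, sum_restrictGroup]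
    calc D c = ∑ g, lin (restrictGroup grp g c) - a ^ 2 *
          ∑ g, ∑ r, ∑ t, ‖(C (restrictGroup grp g c) *ᵥ H.col r) t‖ ^ 2 := by rw [← hE, ← hL]
      _ = _ := by rw [Finset.mul_sum, ← Finset.sum_sub_distrib]
  let ext (g : Fin q) (w : {p : P // grp p = g} → ℂ) : P → ℂ :=
    fun p => if h : grp p = g then w ⟨p, h⟩ else 0
  -- The constant is shared equally among the q groups, hence the need for q > 0.
  let metric (g : Fin q) (w : {p : P // grp p = g} → ℂ) : ℝ := K₀ / q + D (ext g w)
  have hext (g : Fin q) (c : P → ℂ) : ext g (fun p => c p.1) = restrictGroup grp g c := by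
    ext p
    simp [ext, restrictGroup]
  have hsum (c : P → ℂ) :
      Real.log (C.likelihood ρ H X c) = ∑ g, metric g (fun p => c p.1) := by
    have hq' : (q : ℝ) ≠ 0 := Nat.cast_ne_zero.2 hq.ne'
    calc Real.log (C.likelihood ρ H X c) = K₀ + ∑ g, D (restrictGroup grp g c) := by rw [hlog, ← hD]
      _ = ∑ g, (K₀ / q + D (restrictGroup grp g c)) := by
        rw [Finset.sum_add_distrib, Finset.sum_const, Finset.card_univ, Fintype.card_fin,
          nsmul_eq_mul, mul_div_cancel₀ _ hq']
      _ = _ := Finset.sum_congr rfl fun g _ => by rw [← hext]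
  exact ⟨metric, hsum, C.isMLDecision_iff_of_log_likelihood_eq_sum ρ H X grp metric hsum⟩

end General

/-! ### Additivity and symbol groups of the proposed code -/

theorem codeMatrix_add (k : ℕ) (s t : Idx k → ℂ) :
    codeMatrix k (s + t) = codeMatrix k s + codeMatrix k t := by
  induction k with
  | zero => rfl
  | succ k ih =>
    rw [codeMatrix, codeMatrix, codeMatrix, Matrix.fromBlocks_add, ← neg_add, ← ih, ← ih, ← ih,
      ← ih]
    simp only [Pi.add_apply, star_add]
    rfl

theorem proposedCode_add (k n : ℕ) (θ : Idx (k + 1) → ℝ) {M : ℕ} (J : Fin M ↪ Idx (k + 1))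
    (c c' : Idx (k + 1) → ℂ) :
    proposedCode k n θ J (c + c') = proposedCode k n θ J c + proposedCode k n θ J c' := by
  rw [proposedCode, Matrix.mulVec_add, codeMatrix_add]
  rfl

theorem proposedCode_sub (k n : ℕ) (θ : Idx (k + 1) → ℝ) {M : ℕ} (J : Fin M ↪ Idx (k + 1))
    (c c' : Idx (k + 1) → ℂ) :
    proposedCode k n θ J c - proposedCode k n θ J c' = proposedCode k n θ J (c - c') := by
  rw [sub_eq_iff_eq_add, ← proposedCode_add, sub_add_cancel]

/-- A group is a partition together with a block. Each eigenbasis coordinate sees one group only, so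
the energy, a weighted sum of squared coordinates, has no cross terms. -/
theorem proposedCode_mlDecodesJointly (k r : ℕ) (hr : r ≤ k) (θ : Idx (k + 1) → ℝ) {M : ℕ}
    (J : Fin M ↪ Idx (k + 1)) :
    (proposedCode k (r + 1) θ J).MLDecodesJointly (2 ^ (k - r)) := by
  classical
  let e := Fintype.equivFin (Bool × Idx r)
  let grp (p : Idx (k + 1)) : Fin (Fintype.card (Bool × Idx r)) :=
    e (((slotEquiv k).symm p).1, blk k r ((slotEquiv k).symm p).2)
  have hcoeff (i : Bool) (j : Idx k) (p : Idx (k + 1)) (hp : grp p ≠ e (i, blk k r j)) :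
      precoderCoeff k r i j p = 0 := by
    by_contra hne
    obtain ⟨⟨i', q⟩, rfl⟩ := (slotEquiv k).surjective p
    obtain ⟨rfl, hq⟩ := (precoderCoeff_slot_ne_zero_iff k r hr i i' j q).1 hne
    exact hp (by simp [grp, hq])
  have hcoord (i : Bool) (j : Idx k) (c : Idx (k + 1) → ℂ) :
      ‖eigCoord k i (precoder k (r + 1) θ *ᵥ c) j‖ ^ 2 =
        ∑ g, ‖eigCoord k i (precoder k (r + 1) θ *ᵥ restrictGroup grp g c) j‖ ^ 2 := by
    rw [Finset.sum_eq_single (e (i, blk k r j))]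
    · rw [eigCoord_precoder_mulVec_apply, eigCoord_precoder_mulVec_apply]
      congr 2
      refine Finset.sum_congr rfl fun p _ => ?_
      by_cases hp : grp p = e (i, blk k r j)
      · rw [restrictGroup, if_pos hp]
      · rw [hcoeff i j p hp, zero_mul, zero_mul, zero_mul, zero_mul]
    · intro g _ hg
      rw [eigCoord_precoder_mulVec_apply, Finset.sum_eq_zero, norm_zero, zero_pow two_ne_zero]
      intro p _
      by_cases hp : grp p = e (i, blk k r j)
      · rw [restrictGroup, if_neg (by rw [hp]; exact hg.symm), mul_zero, zero_mul]
      · rw [hcoeff i j p hp, zero_mul, zero_mul]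
    · exact fun h => absurd (Finset.mem_univ _) h
  have henergy (c : Idx (k + 1) → ℂ) (h : Fin M → ℂ) :
      ∑ t, ‖(proposedCode k (r + 1) θ J c *ᵥ h) t‖ ^ 2 = ∑ j, 2 ^ k *
        eigNorm k (precoder k (r + 1) θ *ᵥ c) j * eigNorm k (Function.extend J h 0) j := by
    rw [proposedCode, ← mulVec_extend, sum_norm_sq_codeMatrix_mulVec]
  refine Code.mlDecodesJointly_of_energy _ _ _ ?_ grp (fun g => ?_) (proposedCode_add _ _ _ _)
    fun h c => ?_
  · rw [Fintype.card_prod, Fintype.card_bool, card_idx]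
    positivity
  · obtain ⟨⟨i, β⟩, rfl⟩ := e.surjective g
    have hset : (Finset.univ.filter fun p => grp p = e (i, β)) =
        (({i} : Finset Bool) ×ˢ Finset.univ.filter fun j => blk k r j = β).map
          (slotEquiv k).toEmbedding := by
      ext p
      obtain ⟨⟨i', q⟩, rfl⟩ := (slotEquiv k).surjective p
      simp [grp, and_comm, eq_comm (a := i)]
    rw [Nat.card_eq_fintype_card, Fintype.card_subtype, hset, Finset.card_map,
      Finset.card_product, Finset.card_singleton, one_mul, card_blk_eq k r hr]
  · simp only [henergy]
    rw [Finset.sum_comm]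
    refine Finset.sum_congr rfl fun j _ => ?_
    rw [← Finset.sum_mul, ← Finset.mul_sum]
    simp only [eigNorm]
    rw [Finset.sum_add_distrib, ← hcoord, ← hcoord]

/-! ### Diversity -/

theorem exists_pair_single (k : ℕ) (𝒜 : Finset ℂ) (h𝒜 : 2 ≤ 𝒜.card) (p : Idx (k + 1)) :
    ∃ (u v : Idx (k + 1) → ℂ) (z : ℂ), (∀ j, u j ∈ 𝒜) ∧ (∀ j, v j ∈ 𝒜) ∧ z ≠ 0 ∧
      u - v = Pi.single p z := by
  obtain ⟨a, ha, b, hb, hab⟩ := Finset.one_lt_card.1 h𝒜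
  refine ⟨Function.update (fun _ => b) p a, fun _ => b, a - b, fun j => ?_, fun _ => hb,
    sub_ne_zero.2 hab, ?_⟩
  · by_cases hj : j = p
    · rw [hj, Function.update_self]
      exact ha
    · rw [Function.update_of_ne hj]
      exact hb
  · ext j
    by_cases hj : j = p
    · subst hj
      simp
    · simp [hj]

theorem rank_codeMatrix_precoder_single_le (k r : ℕ) (hr : r ≤ k) (θ : Idx (k + 1) → ℝ)
    (p : Idx (k + 1)) (z : ℂ) :
    (codeMatrix (k + 1) (precoder k (r + 1) θ *ᵥ Pi.single p z)).rank ≤ 2 ^ (k - r + 1) := by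
  obtain ⟨i, q, rfl⟩ := slot_surjective k p
  exact rank_codeMatrix_le k r hr _ (blk k r q) fun i' j hne =>
    (eigCoord_precoder_single k r hr θ i' i j q z hne).2

/-- A symbol in which u and v differ enters every coordinate of its block with nonzero coefficient,
so a generic rotation keeps all of these from cancelling. -/
theorem exists_rotation_eigNorm_ne_zero (k r : ℕ) (hr : r ≤ k) (𝒜 : Finset ℂ) :
    ∃ θ : Idx (k + 1) → ℝ, ∀ u v : Idx (k + 1) → ℂ, (∀ p, u p ∈ 𝒜) → (∀ p, v p ∈ 𝒜) → u ≠ v →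
      ∃ β, ∀ j, blk k r j = β → eigNorm k (precoder k (r + 1) θ *ᵥ (u - v)) j ≠ 0 := by
  classical
  let words : Finset (Idx (k + 1) → ℂ) := Fintype.piFinset fun _ => 𝒜
  let f (x : (Bool × Idx k) × (Idx (k + 1) → ℂ) × (Idx (k + 1) → ℂ)) : Idx (k + 1) → ℂ :=
    fun p => precoderCoeff k r x.1.1 x.1.2 p * (x.2.1 - x.2.2) p
  -- Coefficient vectors that vanish identically are discarded, since no rotation affects them.
  obtain ⟨θ, hθ⟩ := exists_rotation_sum_ne_zero
    (((Finset.univ ×ˢ words ×ˢ words).image f).filter (· ≠ 0)) fun w hw => (Finset.mem_filter.1 hw).2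
  refine ⟨θ, fun u v hu hv huv => ?_⟩
  obtain ⟨p, hp⟩ := Function.ne_iff.1 (sub_ne_zero.2 huv)
  obtain ⟨i, q, rfl⟩ := slot_surjective k p
  refine ⟨blk k r q, fun j hj h0 => ?_⟩
  refine hθ (f ((i, j), u, v)) ?_ ?_
  · refine Finset.mem_filter.2 ⟨Finset.mem_image_of_mem f ?_, Function.ne_iff.2 ⟨slot k i q, ?_⟩⟩
    · exact Finset.mem_product.2 ⟨Finset.mem_univ _, Finset.mem_product.2
        ⟨Fintype.mem_piFinset.2 hu, Fintype.mem_piFinset.2 hv⟩⟩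
    · exact mul_ne_zero ((precoderCoeff_slot_ne_zero_iff k r hr i i j q).2 ⟨rfl, hj⟩) hp
  · rw [← eigNorm_eq_zero_iff.1 h0 i, eigCoord_precoder_mulVec_apply]

theorem proposedCode_exists_hasDiversity (k r : ℕ) (hr : r ≤ k) (M : ℕ) (hM : M ≤ 2 ^ (k + 1)) :
    ∃ J : Fin M ↪ Idx (k + 1), ∀ 𝒜 : Finset ℂ, 2 ≤ 𝒜.card → ∃ θ : Idx (k + 1) → ℝ,
      (proposedCode k (r + 1) θ J).HasDiversity 𝒜 (min M (2 ^ (k - r + 1))) := by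
  obtain ⟨F, hF, hinj⟩ := exists_columns_injective k r hr
  obtain ⟨J, hJ⟩ := exists_embedding_initial_mem F M (by rwa [card_idx])
  refine ⟨J, fun 𝒜 h𝒜 => ?_⟩
  obtain ⟨θ, hθ⟩ := exists_rotation_eigNorm_ne_zero k r hr 𝒜
  refine ⟨θ, ?_⟩
  have hlower : ∀ u v : Idx (k + 1) → ℂ, (∀ p, u p ∈ 𝒜) → (∀ p, v p ∈ 𝒜) → u ≠ v →
      min M (2 ^ (k - r + 1)) ≤
        (proposedCode k (r + 1) θ J u - proposedCode k (r + 1) θ J v).rank := by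
    intro u v hu hv huv
    obtain ⟨β, hβ⟩ := hθ u v hu hv huv
    rw [proposedCode_sub, ← hF]
    exact le_rank_submatrix_codeMatrix k r _ β hβ F (hinj β) J hJ
  refine ⟨?_, ?_⟩
  -- The minimum is attained by any two words differing in a single symbol.
  · obtain ⟨u, v, z, hu, hv, hz, huv⟩ := exists_pair_single k 𝒜 h𝒜 (Classical.choice (nonempty_idx _))
    have hne : u ≠ v := by
      rw [← sub_ne_zero, huv]
      simpa using hz
    refine ⟨u, v, hu, hv, hne, le_antisymm (hlower u v hu hv hne) (le_min ?_ ?_)⟩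
    · exact (Matrix.rank_le_card_width _).trans_eq (Fintype.card_fin M)
    · rw [proposedCode_sub, huv]
      exact (rank_submatrix_id_le _ J).trans (rank_codeMatrix_precoder_single_le k r hr θ _ z)
  · rintro _ ⟨u, v, hu, hv, hne, rfl⟩
    exact hlower u v hu hv hne

theorem le_of_proposedCode_hasDiversity (k r : ℕ) (hr : r ≤ k) (θ : Idx (k + 1) → ℝ) {M d : ℕ}
    (J : Fin M ↪ Idx (k + 1)) (𝒜 : Finset ℂ) (h𝒜 : 2 ≤ 𝒜.card)
    (h : (proposedCode k (r + 1) θ J).HasDiversity 𝒜 d) : d ≤ 2 ^ (k - r + 1) := by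
  obtain ⟨u, v, z, hu, hv, hz, huv⟩ := exists_pair_single k 𝒜 h𝒜 (Classical.choice (nonempty_idx _))
  have hne : u ≠ v := by
    rw [← sub_ne_zero, huv]
    simpa using hz
  refine (h.2 ⟨u, v, hu, hv, hne, rfl⟩).trans ?_
  rw [proposedCode_sub, huv]
  exact (rank_submatrix_id_le _ J).trans (rank_codeMatrix_precoder_single_le k r hr θ _ z)

/-! ### The minimum determinant for single-symbol decoding -/

theorem det_eq_zero_of_rank_lt {n : Type*} [Fintype n] [DecidableEq n] (A : Matrix n n ℂ)
    (h : A.rank < Fintype.card n) : A.det = 0 := by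
  by_contra hdet
  have := Matrix.rank_of_isUnit A ((Matrix.isUnit_iff_isUnit_det A).2 (isUnit_iff_ne_zero.2 hdet))
  omega

theorem eigCoord_partition (k : ℕ) (i i' : Bool) (s : Idx (k + 1) → ℂ) (j : Idx k) :
    eigCoord k i' (partition (k + 1) i s) j = if i' = i then eigCoord k i s j else 0 := by
  split_ifs with h
  · rw [h, eigCoord, partMat_mulVec_partition, eigCoord]
  · obtain rfl : i' = !i := by cases i <;> cases i' <;> simp_all
    rw [eigCoord, partMat_mulVec_partition_not, Matrix.mulVec_zero, Pi.zero_apply]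

theorem two_pow_lt_card_idx (k : ℕ) (hk : 1 ≤ k) :
    2 ^ (k - k + 1) < Fintype.card (Idx (k + 1)) := by
  rw [card_idx]
  exact Nat.pow_lt_pow_right (by norm_num) (by omega)

theorem isLeast_det_partition (k : ℕ) (hk : 1 ≤ k) (θ : Idx (k + 1) → ℝ) (𝒜 : Finset ℂ)
    (h𝒜 : 2 ≤ 𝒜.card) (i : Bool) :
    IsLeast {x : ℝ | ∃ c e : Idx (k + 1) → ℂ, (∀ j, c j ∈ 𝒜) ∧ (∀ j, e j ∈ 𝒜) ∧
      partition (k + 1) i c ≠ partition (k + 1) i e ∧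
      x = ‖(codeMatrix (k + 1) (partition (k + 1) i
        ((precoder k (k + 1) θ).mulVec (c - e)))).det‖} 0 := by
  refine ⟨?_, ?_⟩
  · obtain ⟨q⟩ := nonempty_idx k
    obtain ⟨u, v, z, hu, hv, hz, huv⟩ := exists_pair_single k 𝒜 h𝒜 (slot k i q)
    refine ⟨u, v, hu, hv, fun h => hz ?_, ?_⟩
    · obtain ⟨ε, hε, hq⟩ := exists_partMat_mulVec k i q
      have h1 : (partMat k i *ᵥ u) q = (partMat k i *ᵥ v) q := by
        rw [← partMat_mulVec_partition, h, partMat_mulVec_partition]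
      rw [hq, hq] at h1
      have h2 := congrFun huv (slot k i q)
      rw [Pi.single_eq_same, Pi.sub_apply, mul_left_cancel₀ hε h1, sub_self] at h2
      exact h2.symm
    -- With blocks of size 1 a single changed symbol gives rank at most 2, below the size 2^(k+1) ≥
    -- 4.
    · rw [huv, det_eq_zero_of_rank_lt, norm_zero]
      refine lt_of_le_of_lt (rank_codeMatrix_le k k le_rfl _ (blk k k q) fun i' j hne => ?_)
        (two_pow_lt_card_idx k hk)
      rw [eigCoord_partition] at hne
      exact (eigCoord_precoder_single k k le_rfl θ i i j q z
        fun h0 => hne (by rw [h0, ite_self])).2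
  · rintro _ ⟨c, e, -, -, -, rfl⟩
    exact norm_nonneg _

theorem isLeast_det (k : ℕ) (hk : 1 ≤ k) (θ : Idx (k + 1) → ℝ) (𝒜 : Finset ℂ)
    (h𝒜 : 2 ≤ 𝒜.card) :
    IsLeast {x : ℝ | ∃ c e : Idx (k + 1) → ℂ, (∀ j, c j ∈ 𝒜) ∧ (∀ j, e j ∈ 𝒜) ∧ c ≠ e ∧
      x = ‖(codeMatrix (k + 1) ((precoder k (k + 1) θ).mulVec (c - e))).det‖} 0 := by
  refine ⟨?_, ?_⟩
  · obtain ⟨u, v, z, hu, hv, hz, huv⟩ := exists_pair_single k 𝒜 h𝒜 (Classical.choice (nonempty_idx _))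
    refine ⟨u, v, hu, hv, fun h => hz ?_, ?_⟩
    · rw [h, sub_self] at huv
      exact (Pi.single_eq_zero_iff.1 huv.symm)
    · rw [huv, det_eq_zero_of_rank_lt, norm_zero]
      exact (rank_codeMatrix_precoder_single_le k k le_rfl θ _ z).trans_lt
        (two_pow_lt_card_idx k hk)
  · rintro _ ⟨c, e, -, -, -, rfl⟩
    exact norm_nonneg _

end STBC

/-! ### Assembly of the five claims -/

theorem mainTheorem6 (M k n : ℕ) (hM : Nat.clog 2 M = k + 1) (hn : 1 ≤ n) (hnM : n ≤ k + 1) :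
    -- `W_{L,i}` is unitary and diagonalises the equivalent channel, whatever the channel `h`
    (∀ i : Bool, STBC.eigMat k i ∈ Matrix.unitaryGroup (STBC.Idx k) ℂ ∧
      ∀ h : STBC.Idx (k + 1) → ℂ, ∃ lam : STBC.Idx k → ℝ, (∀ j, 0 ≤ lam j) ∧
        ∀ s : STBC.Idx (k + 1) → ℂ,
          ∑ t, ‖(STBC.codeMatrix (k + 1) (STBC.partition (k + 1) i s)).mulVec h t‖ ^ 2 =
            ∑ j, lam j *
              ‖(STBC.eigMat k i).conjTranspose.mulVec ((STBC.partMat k i).mulVec s) j‖ ^ 2) ∧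
    -- power normalisation, rate and decoding complexity, for all rotations and column choices
    (∀ (θ : STBC.Idx (k + 1) → ℝ) (J : Fin M ↪ STBC.Idx (k + 1)),
      STBC.precoder k n θ ∈ Matrix.unitaryGroup (STBC.Idx (k + 1)) ℂ ∧
      (STBC.proposedCode k n θ J).rate = 1 ∧
      (STBC.proposedCode k n θ J).MLDecodesJointly (2 ^ (Nat.clog 2 M - n))) ∧
    -- diversity, for a suitable choice of columns and suitable constellation rotations
    (∃ J : Fin M ↪ STBC.Idx (k + 1), ∀ 𝒜 : Finset ℂ, 2 ≤ 𝒜.card →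
      ∃ θ : STBC.Idx (k + 1) → ℝ,
        (STBC.proposedCode k n θ J).HasDiversity 𝒜 (min M (2 ^ (Nat.clog 2 M - n + 1)))) ∧
    -- full diversity is possible only for `n = 1`
    (∀ (θ : STBC.Idx (k + 1) → ℝ) (J : Fin M ↪ STBC.Idx (k + 1)) (𝒜 : Finset ℂ), 2 ≤ 𝒜.card →
      (STBC.proposedCode k n θ J).HasDiversity 𝒜 M → n = 1) ∧
    -- single-symbol decoding gives a zero minimum determinant (more than two antennas)
    (2 < M → n = Nat.clog 2 M → ∀ (θ : STBC.Idx (k + 1) → ℝ) (𝒜 : Finset ℂ), 2 ≤ 𝒜.card →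
      (∀ i : Bool, IsLeast {x : ℝ | ∃ c e : STBC.Idx (k + 1) → ℂ,
        (∀ j, c j ∈ 𝒜) ∧ (∀ j, e j ∈ 𝒜) ∧
        STBC.partition (k + 1) i c ≠ STBC.partition (k + 1) i e ∧
        x = ‖(STBC.codeMatrix (k + 1) (STBC.partition (k + 1) i
          ((STBC.precoder k n θ).mulVec (c - e)))).det‖} 0) ∧
      IsLeast {x : ℝ | ∃ c e : STBC.Idx (k + 1) → ℂ,
        (∀ j, c j ∈ 𝒜) ∧ (∀ j, e j ∈ 𝒜) ∧ c ≠ e ∧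
        x = ‖(STBC.codeMatrix (k + 1) ((STBC.precoder k n θ).mulVec (c - e))).det‖} 0) := by
  obtain ⟨r, rfl⟩ : ∃ r, n = r + 1 := ⟨n - 1, by omega⟩
  have hr : r ≤ k := by omega
  have hle : M ≤ 2 ^ (k + 1) := by
    rw [← hM]
    exact Nat.le_pow_clog (by norm_num) M
  -- Diversity M would give 2^k < M ≤ 2^(k-r+1), which leaves only r = 0.
  have hlt : 2 ^ k < M := Nat.lt_clog_iff_pow_lt (by norm_num) |>.1 (by omega)
  have hsub : k + 1 - (r + 1) = k - r := by omega
  rw [hM, hsub]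
  refine ⟨fun i => ⟨STBC.eigMat_mem_unitaryGroup k i,
    STBC.exists_eigenvalues_equivalent_channel k i⟩, fun θ J => ⟨?_, ?_,
    STBC.proposedCode_mlDecodesJointly k r hr θ J⟩,
    STBC.proposedCode_exists_hasDiversity k r hr M hle, fun θ J 𝒜 h𝒜 hdiv => ?_,
    fun hM2 hn θ 𝒜 h𝒜 => ?_⟩
  · exact Matrix.mem_unitaryGroup_iff.2 (STBC.precoder_mul_conjTranspose k r hr θ)
  · rw [STBC.Code.rate, STBC.card_idx]
    exact div_self (by positivity)
  · have h1 := hlt.trans_le (STBC.le_of_proposedCode_hasDiversity k r hr θ J 𝒜 h𝒜 hdiv)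
    have h2 := (Nat.pow_lt_pow_iff_right (by norm_num)).1 h1
    omega
  · obtain rfl : r = k := by omega
    -- Here M > 2 is used: r = k = 0 would give M ≤ 2.
    have hk : 1 ≤ r := by
      by_contra h0
      obtain rfl : r = 0 := by omega
      omega
    exact ⟨STBC.isLeast_det_partition r hk θ 𝒜 h𝒜, STBC.isLeast_det r hk θ 𝒜 h𝒜⟩
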